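/- Let $m\ge 1$ be an integer. For $n\ge 2$ let Schemmel's totient $S_m(n)$ be the number of runs $a,a+1,\dots,a+m-1$ of $m$ consecutive positive integers, each less than $n$ and coprime to $n$ (and $S_m(1)=1$). Put $P(m)=\prod_{p\le m}p$; the letter $p$ always denotes a prime, $\omega(d)$ is the number of distinct prime factors of $d$, $\mu$ is the Möbius function, and $\{u\}$ is the fractional part of $u$. For real $H$ define $$c_m(H)=\sum_{\substack{d\ge 1\\ (d,P(m))=1}}\frac{\mu^2(d)\,m^{2\omega(d)}}{d^2}\prod_{p\nmid dP(m)}\Big(1-\frac{2m}{p^2}\Big)\sum_{t\mid P(m)}\ \prod_{\substack{p\mid P(m)\\ p\nmid t}}\Big(1-\frac2p\Big)\Big(\Big\{\frac{H}{td}\Big\}-\Big\{\frac{H}{td}\Big\}^2\Big).$$ The infinite products $\prod_{p\nmid P(m)}\big(1-\frac{m}{p^2}\big)$ and $\prod_{p\nmid dP(m)}\big(1-\frac{2m}{p^2}\big)$ converge unconditionally and the series $c_m(H)$ converges absolutely. Moreover, for every $\epsilon>0$, uniformly for real $X\ge 1$ and $0<H\le X^{1-\epsilon}$, $$\frac1X\int_X^{2X}\bigg|\sum_{\substack{x<n\le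 x+H\\ (n,P(m))=1}}\frac{S_m(n)}{n}-\prod_{p\le m}\Big(1-\frac1p\Big)\prod_{p\nmid P(m)}\Big(1-\frac{m}{p^2}\Big)H\bigg|^2dx=c_m(H)+O(H^{-\epsilon}),$$ where the implied constant depends only on $m$ and $\epsilon$. -/

import Mathlib

noncomputable section

/-- Schemmel's totient `S_m(n)`: the number of runs `a, a + 1, …, a + m - 1` of `m` consecutive
integers, each of them less than `n` and coprime to `n`. For `n ≥ 2` and `m ≥ 1` no run counted here
contains `0` or reaches `n` (neither `0` nor `n` is coprime to `n`), so only positive integers less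
than `n` occur, see `schemmelTotient_eq_card`; for `n = 1` the value is `1`, as for Euler's `φ`. -/
def schemmelTotient (m n : ℕ) : ℕ :=
  ((Finset.range n).filter fun a => ∀ i < m, Nat.Coprime (a + i) n).card

/-- For `n ≥ 2`, `S_m(n)` counts the runs of `m` consecutive positive integers that are
less than `n` and coprime to `n`. -/
theorem schemmelTotient_eq_card {m n : ℕ} (hm : 1 ≤ m) (hn : 2 ≤ n) :
    schemmelTotient m n =
      ((Finset.Ico 1 n).filter fun a => ∀ i < m, a + i < n ∧ Nat.Coprime (a + i) n).card := by
  unfold schemmelTotient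
  congr 1
  ext a
  simp only [Finset.mem_filter, Finset.mem_range, Finset.mem_Ico]
  constructor
  · rintro ⟨han, h⟩
    refine ⟨⟨?_, han⟩, fun i hi => ⟨?_, h i hi⟩⟩
    · rcases Nat.eq_zero_or_pos a with rfl | ha
      · have := h 0 (by omega)
        simp at this
        omega
      · exact ha
    · by_contra! hc
      have := h (n - a) (by omega)
      rw [Nat.add_sub_cancel' han.le, Nat.coprime_self] at this
      omega
  · rintro ⟨⟨_, han⟩, h⟩
    exact ⟨han, fun i hi => (h i hi).2⟩

/-- The sum of `S_m(n) / n` over the integers `n` with `x < n ≤ x + H` and `(n, P(m)) = 1`, for real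
`x, H ≥ 0`, where `P(m) = primorial m` is the product of the primes `p ≤ m`. -/
def schemmelShortSum (m : ℕ) (H x : ℝ) : ℝ :=
  ∑ n ∈ (Finset.Ioc ⌊x⌋₊ ⌊x + H⌋₊).filter (fun n => Nat.Coprime n (primorial m)),
    (schemmelTotient m n : ℝ) / n

/-- The factor `1 - m / p ^ 2` of the mean value, for the primes `p` not dividing `P(m)`. -/
def schemmelMeanFactor (m : ℕ) (p : Nat.Primes) : ℝ :=
  if (p : ℕ) ∣ primorial m then 1 else 1 - (m : ℝ) / (p : ℝ) ^ 2

/-- The mean value `∏_{p ≤ m} (1 - 1 / p) * ∏_{p ∤ P(m)} (1 - m / p ^ 2)`. -/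
def schemmelMean (m : ℕ) : ℝ :=
  (∏ p ∈ (Finset.range (m + 1)).filter Nat.Prime, (1 - 1 / (p : ℝ))) *
    ∏' p : Nat.Primes, schemmelMeanFactor m p

/-- The factor `1 - 2 m / p ^ 2`, for the primes `p` not dividing `d P(m)`. -/
def schemmelVarFactor (m d : ℕ) (p : Nat.Primes) : ℝ :=
  if (p : ℕ) ∣ d * primorial m then 1 else 1 - 2 * (m : ℝ) / (p : ℝ) ^ 2

/-- The term of index `d` of the series `c_m(H)`, over all `d ≥ 1` coprime to `P(m)`. -/
def schemmelVarTerm (m : ℕ) (H : ℝ) (d : ℕ) : ℝ :=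
  if 1 ≤ d ∧ Nat.Coprime d (primorial m) then
    (ArithmeticFunction.moebius d : ℝ) ^ 2 *
        (m : ℝ) ^ (2 * ArithmeticFunction.cardDistinctFactors d) / (d : ℝ) ^ 2 *
      (∏' p : Nat.Primes, schemmelVarFactor m d p) *
      ∑ t ∈ (primorial m).divisors,
        (∏ p ∈ (primorial m).primeFactors.filter (fun p => ¬ p ∣ t), (1 - 2 / (p : ℝ))) *
          (Int.fract (H / (t * d)) - Int.fract (H / (t * d)) ^ 2)
  else 0

/-- The main term `c_m(H)` of the variance. -/
def schemmelVarConst (m : ℕ) (H : ℝ) : ℝ :=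
  ∑' d : ℕ, schemmelVarTerm m H d

end

/-! Restricted to n coprime to P(m), the ratio S_m(n)/n is a divisor sum of a multiplicative
coefficient h supported on squarefree numbers, with h(p) = -1 for p ≤ m and h(p) = -m/p for p > m;
hence |h(d)| ≪ d^(δ-1) for every δ > 0. For integers a and L, the centred sum over (a, a + L] is -∑
h(d) saw_d(a) up to a small tail, where saw_d is d-periodic with mean zero. The second moment
therefore reduces to the correlations ∑_a saw_d(a) saw_e(a).

The heart is `abs_sum_saw_mul_saw_sub_le`. For d ≤ e, writing saw_e through the indicator of
multiples of e turns the correlation into a sum of the autocorrelation of saw_d over consecutive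
multiples of e. That autocorrelation has a nonnegative Fourier transform of total mass at most L, so
its deviation from the mean is controlled by geometric sums. A single e may be bad, but the average
over residues of e modulo d costs only L(1 + log d) (`sum_resError_le`). With weights 1/(de) the
total error is O(L (1 + log D)^3) (`sum_sum_sawError_div_le`), and the coefficients h cost only a
small power of X.

The main term is the double series ∑ h(d)h(e) · mean(saw_d saw_e), whose mean factor depends on
gcd(d, e) apart from 1/(de). Grouping by g = gcd(d, e) is a finite subset identity over the primes
up to z (`sum_powerset_inter`) followed by z → ∞; splitting g = td with t ∣ P(m) and (d, P(m)) = 1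
then yields c_m(H) (`hasSum_schemmelVarTerm`).

For real H with fractional part θ, the window starting in [a, a + 1) contains ⌊H⌋ or ⌊H⌋ + 1
integers, with proportions 1 - θ and θ. Since {y} - {y}² is one parabola between consecutive
multiples of 1/g, the main term interpolates with exactly the matching correction
(`schemmelVar_interpolate`). Choosing the power loss to be X^(ε²) makes H X^(ε² - 1) ≤ H^(-ε) in the
range H ≤ X^(1-ε). -/

open Finset

/-! ### Divisor-sum representation of the totient ratio -/

/-- The value at the prime `p` of the coefficients `schemmelCoeff m`. -/
noncomputable def schemmelLocal (m p : ℕ) : ℝ := if p ≤ m then -1 else -(m : ℝ) / p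

/-- The coefficients `h` with `∑ d ∣ n, h d = S_m(n) / n` for `n` coprime to `P(m)`, and `0` otherwise. -/
noncomputable def schemmelCoeff (m n : ℕ) : ℝ :=
  if Squarefree n then ∏ p ∈ n.primeFactors, schemmelLocal m p else 0

/-- Squarefree divisors of n correspond to sets of prime factors of n. The weight φ need not be
multiplicative, so gcd-dependent weights are allowed later. -/
theorem sum_divisors_squarefree_prod (b : ℕ → ℝ) {n : ℕ} (hn : n ≠ 0) (φ : ℕ → ℝ) :
    ∑ d ∈ n.divisors, (if Squarefree d then ∏ p ∈ d.primeFactors, b p else 0) * φ d =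
      ∑ A ∈ n.primeFactors.powerset, (∏ p ∈ A, b p) * φ (∏ p ∈ A, p) := by
  have h1 : ∑ d ∈ n.divisors, (if Squarefree d then ∏ p ∈ d.primeFactors, b p else 0) * φ d =
      ∑ d ∈ n.divisors with Squarefree d, (∏ p ∈ d.primeFactors, b p) * φ d := by
    rw [Finset.sum_filter]
    exact Finset.sum_congr rfl fun d _ => by split_ifs <;> simp
  rw [h1]
  refine Finset.sum_nbij' (fun d => d.primeFactors) (fun A => ∏ p ∈ A, p) ?_ ?_ ?_ ?_ ?_
  · intro d hd
    simp only [mem_filter, Nat.mem_divisors] at hd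
    simpa using Nat.primeFactors_mono hd.1.1 hn
  · intro A hA
    rw [mem_powerset] at hA
    have hp : ∀ p ∈ A, p.Prime := fun p hp => Nat.prime_of_mem_primeFactors (hA hp)
    simp only [mem_filter, Nat.mem_divisors]
    refine ⟨⟨?_, hn⟩, ?_⟩
    · exact (Finset.prod_dvd_prod_of_subset _ _ _ hA).trans (Nat.prod_primeFactors_dvd n)
    · refine Finset.squarefree_prod_of_pairwise_isCoprime ?_ fun p hpA => (hp p hpA).squarefree
      intro p hpA q hqA hpq
      exact Nat.coprime_iff_isRelPrime.mp ((Nat.coprime_primes (hp p hpA) (hp q hqA)).mpr hpq)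
  · intro d hd
    simp only [mem_filter] at hd
    exact Nat.prod_primeFactors_of_squarefree hd.2
  · intro A hA
    rw [mem_powerset] at hA
    exact Nat.primeFactors_prod fun p hp => Nat.prime_of_mem_primeFactors (hA hp)
  · intro d hd
    simp only [mem_filter] at hd
    rw [Nat.prod_primeFactors_of_squarefree hd.2]

theorem sum_divisors_schemmelCoeff (m : ℕ) {n : ℕ} (hn : n ≠ 0) :
    ∑ d ∈ n.divisors, schemmelCoeff m d = ∏ p ∈ n.primeFactors, (1 + schemmelLocal m p) := by
  have := sum_divisors_squarefree_prod (schemmelLocal m) hn (fun _ => 1)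
  simp only [mul_one] at this
  rw [Finset.prod_one_add, ← this]
  rfl

/-- Coprimality to n depends only on the residue, so the count lives on `ZMod n`, where the Chinese
remainder theorem applies. -/
theorem schemmelTotient_eq_card_zmod (m n : ℕ) [NeZero n] :
    schemmelTotient m n =
      (Finset.univ.filter fun x : ZMod n => ∀ i < m, IsUnit (x + (i : ZMod n))).card := by
  unfold schemmelTotient
  refine Finset.card_nbij' (fun a => (a : ZMod n)) (fun x => x.val) ?_ ?_ ?_ ?_
  · intro a ha
    simp only [coe_filter, mem_range, Set.mem_ofPred_eq, mem_univ, true_and] at ha ⊢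
    intro i hi
    have := (ZMod.isUnit_iff_coprime (a + i) n).mpr (ha.2 i hi)
    simpa using this
  · intro x hx
    simp only [coe_filter, mem_range, Set.mem_ofPred_eq, mem_univ, true_and] at hx ⊢
    refine ⟨ZMod.val_lt x, fun i hi => (ZMod.isUnit_iff_coprime _ n).mp ?_⟩
    simpa using hx i hi
  · intro a ha
    simp only [coe_filter, mem_range, Set.mem_ofPred_eq] at ha
    exact ZMod.val_cast_of_lt ha.1
  · intro x _
    simp

theorem schemmelTotient_mul {m a b : ℕ} [NeZero a] [NeZero b] (h : a.Coprime b) :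
    schemmelTotient m (a * b) = schemmelTotient m a * schemmelTotient m b := by
  rw [schemmelTotient_eq_card_zmod, schemmelTotient_eq_card_zmod, schemmelTotient_eq_card_zmod,
    ← Finset.card_product]
  refine Finset.card_equiv (ZMod.chineseRemainder h).toEquiv ?_
  intro x
  simp only [mem_filter, mem_univ, true_and, mem_product]
  have key : ∀ i : ℕ, IsUnit (x + (i : ZMod (a * b))) ↔
      IsUnit ((ZMod.chineseRemainder h x).1 + (i : ZMod a)) ∧
        IsUnit ((ZMod.chineseRemainder h x).2 + (i : ZMod b)) := by
    intro i
    rw [← MulEquiv.isUnit_map (ZMod.chineseRemainder h), map_add, map_natCast, Prod.isUnit_iff]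
    rfl
  simp only [key]
  exact ⟨fun H => ⟨fun i hi => (H i hi).1, fun i hi => (H i hi).2⟩,
    fun H i hi => ⟨H.1 i hi, H.2 i hi⟩⟩

/-- The condition on a has period p, and within one period the admissible starts are 1, …, p - m:
the run must avoid both 0 and p. -/
theorem schemmelTotient_prime_pow {m p k : ℕ} (hp : p.Prime) (hmp : m ≤ p) (hm : 1 ≤ m) :
    schemmelTotient m (p ^ (k + 1)) = p ^ k * (p - m) := by
  unfold schemmelTotient
  have h1 : ∀ a : ℕ, (∀ i < m, Nat.Coprime (a + i) (p ^ (k + 1))) ↔ ∀ i < m, ¬ p ∣ a + i := by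
    intro a
    refine forall₂_congr fun i _ => ?_
    rw [Nat.coprime_pow_right_iff (Nat.succ_pos k), Nat.coprime_comm, hp.coprime_iff_not_dvd]
  simp only [h1]
  have hper : Function.Periodic (fun a => ∀ i < m, ¬ p ∣ a + i) p := by
    intro a
    simp only [eq_iff_iff]
    refine forall₂_congr fun i _ => ?_
    rw [show a + p + i = a + i + p by ring, Nat.dvd_add_self_right]
  have h2 : Nat.count (fun a => ∀ i < m, ¬ p ∣ a + i) p = p - m := by
    rw [Nat.count_eq_card_filter_range]
    have : (range p).filter (fun a => ∀ i < m, ¬ p ∣ a + i) = Finset.Ico 1 (p - m + 1) := by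
      ext a
      simp only [mem_filter, mem_range, Finset.mem_Ico]
      constructor
      · rintro ⟨hap, h⟩
        refine ⟨?_, ?_⟩
        · by_contra! hc
          have : a = 0 := by omega
          have := h 0 (by omega)
          simp_all
        · by_contra! hc
          refine h (p - a) (by omega) ?_
          rw [Nat.add_sub_cancel' hap.le]
      · rintro ⟨h1, h2⟩
        refine ⟨by omega, fun i hi hd => ?_⟩
        have := Nat.le_of_dvd (by omega) hd
        omega
    rw [this, Nat.card_Ico]
    omega
  have h3 : ∀ j : ℕ, ((range (j * p)).filter (fun a => ∀ i < m, ¬ p ∣ a + i)).card = j * (p - m) := by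
    intro j
    induction j with
    | zero => simp
    | succ j ih =>
      have : range ((j + 1) * p) = range (j * p) ∪ Finset.Ico (j * p) (j * p + p) := by
        ext a
        simp only [mem_range, Finset.mem_union, Finset.mem_Ico, add_mul, one_mul]
        omega
      rw [this, filter_union, card_union_of_disjoint, ih, Nat.filter_Ico_card_eq_of_periodic _ _ _ hper,
        h2]
      · ring
      · refine disjoint_filter_filter ?_
        rw [Finset.disjoint_left]
        intro a
        simp only [mem_range, Finset.mem_Ico]
        omega
  rw [pow_succ, h3]

theorem schemmelTotient_div {m : ℕ} (hm : 1 ≤ m) (n : ℕ) (hn : 0 < n)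
    (h : ∀ p, p.Prime → p ∣ n → m < p) :
    (schemmelTotient m n : ℝ) / n = ∏ p ∈ n.primeFactors, (1 - (m : ℝ) / p) := by
  induction n using Nat.recOnPosPrimePosCoprime with
  | prime_pow p k hp hk =>
    obtain ⟨k, rfl⟩ : ∃ j, k = j + 1 := ⟨k - 1, by omega⟩
    have hmp := h p hp (dvd_pow_self p (Nat.succ_ne_zero k))
    have hp0 : (p : ℝ) ≠ 0 := by exact_mod_cast hp.ne_zero
    rw [schemmelTotient_prime_pow hp hmp.le hm, Nat.primeFactors_prime_pow (Nat.succ_ne_zero k) hp,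
      Finset.prod_singleton]
    push_cast [Nat.cast_sub hmp.le]
    field_simp
    ring
  | zero => omega
  | one => simp [schemmelTotient]
  | coprime a b ha hb hab iha ihb =>
    have : NeZero a := ⟨by omega⟩
    have : NeZero b := ⟨by omega⟩
    rw [schemmelTotient_mul hab, hab.primeFactors_mul, Finset.prod_union hab.disjoint_primeFactors,
      ← iha (by omega) fun p hp hd => h p hp (hd.mul_right b),
      ← ihb (by omega) fun p hp hd => h p hp (hd.mul_left a)]
    push_cast
    rw [mul_div_mul_comm]

/-- The local value -1 at p ≤ m makes the factor 1 + h(p) vanish, so the coprimality condition is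
built into the coefficients. -/
theorem sum_divisors_schemmelCoeff_eq {m : ℕ} (hm : 1 ≤ m) {n : ℕ} (hn : 0 < n) :
    ∑ d ∈ n.divisors, schemmelCoeff m d =
      if Nat.Coprime n (primorial m) then (schemmelTotient m n : ℝ) / n else 0 := by
  rw [sum_divisors_schemmelCoeff m hn.ne']
  split_ifs with hc
  · have hp : ∀ p, p.Prime → p ∣ n → m < p := by
      intro p hp hd
      by_contra! hle
      exact Nat.not_coprime_of_dvd_of_dvd hp.one_lt hd ((hp.dvd_primorial_iff).mpr hle) hc
    rw [schemmelTotient_div hm n hn hp]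
    refine Finset.prod_congr rfl fun p hpn => ?_
    have := hp p (Nat.prime_of_mem_primeFactors hpn) (Nat.dvd_of_mem_primeFactors hpn)
    rw [schemmelLocal, if_neg (by omega)]
    ring
  · obtain ⟨p, hp, h1, h2⟩ := Nat.Prime.not_coprime_iff_dvd.mp hc
    refine Finset.prod_eq_zero (i := p) (by simp [hp, h1, hn.ne']) ?_
    rw [schemmelLocal, if_pos ((hp.dvd_primorial_iff).mp h2)]
    ring

theorem schemmelShortSum_eq {m : ℕ} (hm : 1 ≤ m) (H x : ℝ) :
    schemmelShortSum m H x =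
      ∑ n ∈ Finset.Ioc ⌊x⌋₊ ⌊x + H⌋₊, ∑ d ∈ n.divisors, schemmelCoeff m d := by
  rw [schemmelShortSum, Finset.sum_filter]
  refine Finset.sum_congr rfl fun n hn => ?_
  rw [sum_divisors_schemmelCoeff_eq hm (by rw [Finset.mem_Ioc] at hn; omega)]

/-- Primes with m ≤ p^δ are paid for by n^δ. The exceptional primes lie below a fixed B, and each
costs at most one factor m + 1. -/
theorem exists_pow_card_primeFactors_le (m : ℕ) {δ : ℝ} (hδ : 0 < δ) :
    ∃ C : ℝ, 1 ≤ C ∧ ∀ n : ℕ, n ≠ 0 → (m : ℝ) ^ n.primeFactors.card ≤ C * (n : ℝ) ^ δ := by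
  obtain ⟨B, hB⟩ : ∃ B : ℕ, ∀ p : ℕ, B ≤ p → (m : ℝ) ≤ (p : ℝ) ^ δ := by
    have := (tendsto_rpow_atTop hδ).comp tendsto_natCast_atTop_atTop
    obtain ⟨B, hB⟩ := Filter.eventually_atTop.mp (this.eventually_ge_atTop (m : ℝ))
    exact ⟨B, hB⟩
  refine ⟨((m : ℝ) + 1) ^ B, one_le_pow₀ (by simp), fun n hn => ?_⟩
  have h1 : (m : ℝ) ^ n.primeFactors.card ≤
      ∏ p ∈ n.primeFactors, ((if p < B then (m : ℝ) + 1 else 1) * (p : ℝ) ^ δ) := by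
    rw [← Finset.prod_const]
    refine Finset.prod_le_prod (fun _ _ => by positivity) fun p hp => ?_
    have hp1 : (1 : ℝ) ≤ p := by exact_mod_cast (Nat.prime_of_mem_primeFactors hp).one_le
    have hp2 : (1 : ℝ) ≤ (p : ℝ) ^ δ := Real.one_le_rpow hp1 hδ.le
    split_ifs with h
    · nlinarith [(Nat.cast_nonneg m : (0 : ℝ) ≤ m)]
    · rw [one_mul]
      exact hB p (by omega)
  refine h1.trans ?_
  rw [Finset.prod_mul_distrib]
  refine mul_le_mul ?_ ?_ (Finset.prod_nonneg fun _ _ => by positivity) (by positivity)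
  · rw [← Finset.prod_filter, Finset.prod_const]
    refine pow_le_pow_right₀ (by simp) ?_
    calc _ ≤ (range B).card := Finset.card_le_card fun p hp => by simp at hp ⊢; exact hp.2
      _ = B := by simp
  · rw [Real.finsetProd_rpow _ _ fun _ _ => by positivity]
    refine Real.rpow_le_rpow (Finset.prod_nonneg fun _ _ => by positivity) ?_ hδ.le
    rw [← Nat.cast_prod]
    exact_mod_cast Nat.le_of_dvd (Nat.pos_of_ne_zero hn) (Nat.prod_primeFactors_dvd n)

theorem schemmelCoeff_zero (m : ℕ) : schemmelCoeff m 0 = 0 := by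
  simp [schemmelCoeff]

/-- At p > m the coefficient is m/p in absolute value. At p ≤ m its absolute value 1 is at most m ·
(m/p), and there are at most m such primes, so they cost the constant m^m. -/
theorem exists_abs_schemmelCoeff_le {m : ℕ} (hm : 1 ≤ m) {δ : ℝ} (hδ : 0 < δ) :
    ∃ C : ℝ, 1 ≤ C ∧ ∀ n : ℕ, n ≠ 0 → |schemmelCoeff m n| ≤ C * (n : ℝ) ^ (δ - 1) := by
  obtain ⟨C, hC1, hC⟩ := exists_pow_card_primeFactors_le m hδ
  obtain ⟨C', hC1', hC'⟩ := exists_pow_card_primeFactors_le m one_pos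
  refine ⟨m ^ m * C, ?_, fun n hn => ?_⟩
  · exact one_le_mul_of_one_le_of_one_le (one_le_pow₀ (by exact_mod_cast hm)) hC1
  have hn0 : (0 : ℝ) < n := by exact_mod_cast Nat.pos_of_ne_zero hn
  rw [schemmelCoeff]
  split_ifs with hsq
  swap
  · rw [abs_zero]; positivity
  have hm1 : (1 : ℝ) ≤ m := by exact_mod_cast hm
  have h1 : |∏ p ∈ n.primeFactors, schemmelLocal m p| ≤
      ∏ p ∈ n.primeFactors, ((if p ≤ m then (m : ℝ) else 1) * (m * (p : ℝ)⁻¹)) := by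
    rw [Finset.abs_prod]
    refine Finset.prod_le_prod (fun _ _ => abs_nonneg _) fun p hp => ?_
    have hp1 : (0 : ℝ) < p := by exact_mod_cast (Nat.prime_of_mem_primeFactors hp).pos
    rw [schemmelLocal]
    split_ifs with h
    · have : (p : ℝ) ≤ m := by exact_mod_cast h
      rw [abs_neg, abs_one, ← div_eq_mul_inv, ← mul_div_assoc, le_div_iff₀ hp1]
      nlinarith
    · rw [neg_div, abs_neg, abs_of_nonneg (by positivity), one_mul, div_eq_mul_inv]
  refine h1.trans ?_
  rw [Finset.prod_mul_distrib, Finset.prod_mul_distrib, Finset.prod_const, Finset.prod_inv_distrib,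
    ← Nat.cast_prod, Nat.prod_primeFactors_of_squarefree hsq, Real.rpow_sub_one hn0.ne',
    mul_assoc, div_eq_mul_inv, ← mul_assoc C]
  refine mul_le_mul ?_ ?_ (by positivity) (by positivity)
  · rw [← Finset.prod_filter, Finset.prod_const]
    refine pow_le_pow_right₀ hm1 ?_
    calc _ ≤ (Finset.Icc 1 m).card := Finset.card_le_card fun p hp => by
            simp at hp ⊢; exact ⟨hp.1.1.one_le, hp.2⟩
      _ = m := by simp
  · gcongr
    exact hC n hn

/-! ### The sawtooth discrepancy modulo d -/

/-- The discrepancy `L / d - #{n ∈ (x, x + L] : d ∣ n}`, as a function of `x` modulo `d`. -/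
noncomputable def saw (d L : ℕ) (x : ZMod d) : ℝ := (((x + L).val : ℝ) - x.val) / d

section Saw
variable {d : ℕ} [NeZero d]

/-- One step raises the representative by 1, except on wrapping to 0, where it drops by d - 1. -/
theorem saw_step (z : ZMod d) :
    (((z + 1).val : ℝ) - z.val) / d = 1 / d - if z + 1 = 0 then 1 else 0 := by
  have hd : (d : ℝ) ≠ 0 := Nat.cast_ne_zero.mpr (NeZero.ne d)
  have hlt := ZMod.val_lt z
  have hz : z + 1 = ((z.val + 1 : ℕ) : ZMod d) := by simp
  rcases eq_or_lt_of_le (Nat.succ_le_of_lt hlt) with h | h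
  · have h0 : z + 1 = 0 := by rw [hz, ← Nat.succ_eq_add_one, h, ZMod.natCast_self]
    have hv : (z.val : ℝ) = d - 1 := by
      have : ((z.val + 1 : ℕ) : ℝ) = d := by exact_mod_cast h
      push_cast at this
      linarith
    rw [h0, if_pos rfl, ZMod.val_zero, hv]
    field_simp
    simp
  · have hv : (z + 1).val = z.val + 1 := by rw [hz, ZMod.val_cast_of_lt h]
    have h0 : z + 1 ≠ 0 := by
      intro h0
      rw [h0, ZMod.val_zero] at hv
      omega
    rw [if_neg h0, hv]
    push_cast
    ring

theorem saw_eq (L : ℕ) (x : ZMod d) :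
    saw d L x = (L : ℝ) / d - ∑ i ∈ range L, if x + ((i : ZMod d) + 1) = 0 then (1 : ℝ) else 0 := by
  induction L with
  | zero => simp [saw]
  | succ L ih =>
    have h := saw_step (x + (L : ZMod d))
    rw [Finset.sum_range_succ]
    have : saw d (L + 1) x = saw d L x + (((x + (L : ZMod d) + 1).val : ℝ) - (x + (L : ZMod d)).val) / d := by
      simp only [saw, Nat.cast_add, Nat.cast_one, ← add_assoc]
      ring
    rw [this, h, ih, add_assoc x]
    push_cast
    ring

theorem sum_saw (L : ℕ) : ∑ x : ZMod d, saw d L x = 0 := by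
  simp only [saw, ← Finset.sum_div, Finset.sum_sub_distrib]
  have h := Equiv.sum_comp (Equiv.addRight (L : ZMod d)) (fun x => ((x.val : ℕ) : ℝ))
  simp only [Equiv.coe_addRight] at h
  rw [h, sub_self, zero_div]

theorem abs_val_sub_val_div_le (x y : ZMod d) : |((x.val : ℝ) - y.val) / d| ≤ 1 := by
  have hd : (0 : ℝ) < d := Nat.cast_pos.mpr (NeZero.pos d)
  have hx : (x.val : ℝ) < d := by exact_mod_cast ZMod.val_lt x
  have hy : (y.val : ℝ) < d := by exact_mod_cast ZMod.val_lt y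
  have hx0 : (0 : ℝ) ≤ x.val := Nat.cast_nonneg _
  have hy0 : (0 : ℝ) ≤ y.val := Nat.cast_nonneg _
  rw [abs_div, abs_of_pos hd, div_le_one hd, abs_le]
  constructor <;> linarith

theorem abs_saw_le (L : ℕ) (x : ZMod d) : |saw d L x| ≤ 1 := abs_val_sub_val_div_le _ _

theorem sum_range_natCast_zmod {M : Type*} [AddCommMonoid M] (F : ZMod d → M) :
    ∑ i ∈ range d, F i = ∑ x : ZMod d, F x := by
  refine Finset.sum_nbij' (fun i => (i : ZMod d)) (fun x => x.val) ?_ ?_ ?_ ?_ ?_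
  · simp
  · intro x _; simpa using ZMod.val_lt x
  · intro i hi; exact ZMod.val_cast_of_lt (by simpa using hi)
  · intro x _; simp
  · simp

/-- A run of l differences with shift L telescopes into a run of L differences with shift l; each of
these is at most 1 in absolute value. -/
theorem abs_sum_saw_run_le (L : ℕ) (x : ZMod d) (l : ℕ) :
    |∑ i ∈ range l, saw d L (x + i)| ≤ L := by
  have h1 : ∑ i ∈ range l, saw d L (x + i) =
      ∑ i ∈ range L, (((x + (l + i : ℕ)).val : ℝ) - (x + i).val) / d := by
    have e1 := Finset.sum_range_add (fun i => ((x + (i : ℕ)).val : ℝ)) L l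
    have e2 := Finset.sum_range_add (fun i => ((x + (i : ℕ)).val : ℝ)) l L
    simp only [saw, ← Finset.sum_div, Finset.sum_sub_distrib]
    rw [add_comm l L] at e2
    have e3 : ∀ i : ℕ, x + (i : ZMod d) + L = x + ((L + i : ℕ) : ZMod d) := by
      intro i; push_cast; ring
    simp only [e3]
    congr 1
    linarith
  rw [h1]
  refine (Finset.abs_sum_le_sum_abs _ _).trans ?_
  calc _ ≤ ∑ i ∈ range L, (1 : ℝ) := Finset.sum_le_sum fun i _ => abs_val_sub_val_div_le _ _
    _ = L := by simp

/-- Complete periods sum to zero, leaving fewer than d terms. -/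
theorem abs_sum_saw_run_le_modulus (L : ℕ) (x : ZMod d) (l : ℕ) :
    |∑ i ∈ range l, saw d L (x + i)| ≤ d := by
  induction l using Nat.strong_induction_on with
  | _ l ih =>
    rcases lt_or_ge l d with h | h
    · refine (Finset.abs_sum_le_sum_abs _ _).trans ?_
      calc _ ≤ ∑ i ∈ range l, (1 : ℝ) := Finset.sum_le_sum fun i _ => abs_saw_le _ _
        _ = l := by simp
        _ ≤ d := by exact_mod_cast h.le
    · obtain ⟨j, rfl⟩ := Nat.exists_eq_add_of_le h
      rw [Finset.sum_range_add, sum_range_natCast_zmod (fun i => saw d L (x + i)),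
        show ∑ i, saw d L (x + i) = 0 from
          (Equiv.sum_comp (Equiv.addLeft x) (saw d L)).trans (sum_saw L), zero_add]
      simpa using ih j (by have := NeZero.pos d; omega)

omit [NeZero d] in
theorem sum_saw_run_reflect (L : ℕ) (x : ZMod d) (l : ℕ) :
    ∑ i ∈ range l, saw d L (x - i) = ∑ i ∈ range l, saw d L (x - (l - 1 : ℕ) + i) := by
  rw [← Finset.sum_range_reflect]
  refine Finset.sum_congr rfl fun i hi => ?_
  have hi : i ≤ l - 1 := by rw [mem_range] at hi; omega
  congr 1
  rw [Nat.cast_sub hi]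
  ring

theorem abs_sum_saw_run_sub_le (L : ℕ) (x : ZMod d) (l : ℕ) :
    |∑ i ∈ range l, saw d L (x - i)| ≤ min (d : ℝ) L := by
  rw [sum_saw_run_reflect]
  exact le_min (abs_sum_saw_run_le_modulus _ _ _) (abs_sum_saw_run_le _ _ _)

theorem abs_sum_Ico_saw_le (L N N' : ℕ) : |∑ a ∈ Ico N N', saw d L a| ≤ min (d : ℝ) L := by
  rw [Finset.sum_Ico_eq_sum_range]
  push_cast
  exact le_min (abs_sum_saw_run_le_modulus _ _ _) (abs_sum_saw_run_le _ _ _)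

/-- The autocorrelation of a function on `ZMod d`. -/
def autocorr (v : ZMod d → ℝ) (n : ZMod d) : ℝ := ∑ a, v a * v (a + n)

theorem autocorr_neg (v : ZMod d → ℝ) (n : ZMod d) : autocorr v (-n) = autocorr v n := by
  unfold autocorr
  rw [← Equiv.sum_comp (Equiv.addRight n)]
  refine Finset.sum_congr rfl fun a _ => ?_
  simp [mul_comm]

/-- Expand one factor by `saw_eq`: the constant L/d is killed by the mean zero of the other factor,
and each indicator selects a single value of it. This is what makes sums over multiples of e
recognisable as autocorrelations. -/
theorem autocorr_saw (L : ℕ) (n : ZMod d) :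
    autocorr (saw d L) n = -∑ i ∈ range L, saw d L (n - ((i : ZMod d) + 1)) := by
  rw [← autocorr_neg, autocorr]
  simp only [saw_eq L (_ + _), mul_sub, Finset.sum_sub_distrib, ← Finset.sum_mul, sum_saw, zero_mul,
    zero_sub, Finset.mul_sum]
  rw [Finset.sum_comm]
  congr 1
  refine Finset.sum_congr rfl fun i _ => ?_
  have : ∀ a : ZMod d, a + -n + ((i : ZMod d) + 1) = 0 ↔ n - ((i : ZMod d) + 1) = a := by
    intro a
    constructor
    · intro h; linear_combination -h
    · intro h; linear_combination -h
  simp [this]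

/-- `{H / g} - {H / g} ^ 2`. -/
noncomputable def fractVar (H : ℝ) (g : ℕ) : ℝ := Int.fract (H / g) - Int.fract (H / g) ^ 2

/-- With r = L mod d, the function takes only the values r/d and r/d - 1, the latter on exactly r
residues. -/
theorem sum_saw_sq (L : ℕ) : ∑ x : ZMod d, saw d L x ^ 2 = d * fractVar L d := by
  have hd : (d : ℝ) ≠ 0 := Nat.cast_ne_zero.mpr (NeZero.ne d)
  have hdp := NeZero.pos d
  set r := L % d with hr
  have hrd : r < d := Nat.mod_lt _ hdp
  have hv : ∀ a < d, saw d L (a : ZMod d) = (r : ℝ) / d - if d - r ≤ a then 1 else 0 := by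
    intro a ha
    have h1 : ((a : ZMod d) + L) = ((a + r : ℕ) : ZMod d) := by
      rw [hr]; push_cast; rw [ZMod.natCast_mod]
    rw [saw, h1, ZMod.val_natCast, ZMod.val_cast_of_lt ha]
    split_ifs with h
    · rw [Nat.mod_eq_sub_mod (by omega), Nat.mod_eq_of_lt (by omega), Nat.cast_sub (by omega)]
      push_cast
      field_simp
      ring
    · rw [Nat.mod_eq_of_lt (by omega)]
      push_cast
      field_simp
      ring
  rw [← sum_range_natCast_zmod (fun x => saw d L x ^ 2)]
  have h2 : ∀ a ∈ range d, saw d L (a : ZMod d) ^ 2 =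
      ((r : ℝ) / d) ^ 2 + (1 - 2 * ((r : ℝ) / d)) * if d - r ≤ a then 1 else 0 := by
    intro a ha
    rw [hv a (by simpa using ha)]
    split_ifs <;> ring
  rw [Finset.sum_congr rfl h2, Finset.sum_add_distrib, ← Finset.mul_sum, Finset.sum_const, card_range,
    ← Finset.sum_filter, Finset.sum_const]
  have h3 : (filter (fun a => d - r ≤ a) (range d)).card = r := by
    have : filter (fun a => d - r ≤ a) (range d) = Finset.Ico (d - r) d := by
      ext a; simp; omega
    rw [this, Nat.card_Ico]; omega
  rw [h3, fractVar, Int.fract_div_natCast_eq_div_natCast_mod, ← hr]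
  simp only [nsmul_eq_mul]
  field_simp
  ring

theorem fractVar_nonneg (H : ℝ) (g : ℕ) : 0 ≤ fractVar H g := by
  have h0 := Int.fract_nonneg (H / g)
  have h1 := (Int.fract_lt_one (H / g)).le
  unfold fractVar
  nlinarith

theorem fractVar_le_one (H : ℝ) (g : ℕ) : fractVar H g ≤ 1 := by
  have h0 := Int.fract_nonneg (H / g)
  have h1 := (Int.fract_lt_one (H / g)).le
  unfold fractVar
  nlinarith

theorem fract_sub_sq_le_abs (y : ℝ) : Int.fract y - Int.fract y ^ 2 ≤ |y| := by
  have h0 := Int.fract_nonneg y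
  have h1 := (Int.fract_lt_one y).le
  rcases le_or_gt 0 y with h | h
  · have : Int.fract y ≤ y := by
      have : (0 : ℝ) ≤ ⌊y⌋ := by exact_mod_cast Int.floor_nonneg.mpr h
      have := Int.floor_add_fract y
      linarith
    rw [abs_of_nonneg h]
    nlinarith
  · have : 1 - Int.fract y ≤ -y := by
      have h2 : ⌊y⌋ ≤ -1 := by
        have : ⌊y⌋ < 0 := Int.floor_lt.mpr (by simpa using h)
        omega
      have h2 : (⌊y⌋ : ℝ) ≤ -1 := by exact_mod_cast h2
      have := Int.floor_add_fract y
      linarith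
    rw [abs_of_neg h]
    nlinarith

theorem fractVar_le (H : ℝ) (g : ℕ) : fractVar H g ≤ |H| / g := by
  refine (fract_sub_sq_le_abs (H / g)).trans_eq ?_
  rw [abs_div, Nat.abs_cast]

theorem autocorr_saw_zero_le (L : ℕ) : autocorr (saw d L) 0 ≤ L := by
  have hd : (0 : ℝ) < d := Nat.cast_pos.mpr (NeZero.pos d)
  have : autocorr (saw d L) 0 = ∑ x : ZMod d, saw d L x ^ 2 := by
    simp only [autocorr, add_zero, sq]
  rw [this, sum_saw_sq]
  have := fractVar_le L d
  rw [le_div_iff₀ hd, Nat.abs_cast] at this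
  linarith

end Saw

/-! ### Power spectrum and sums along progressions -/

section Fourier
variable {d : ℕ} [NeZero d]
open ZMod (stdAddChar)

/-- The power spectrum of a function on `ZMod d`. -/
noncomputable def powerSpectrum (v : ZMod d → ℝ) (k : ZMod d) : ℝ :=
  ‖∑ a, (v a : ℂ) * stdAddChar (k * a)‖ ^ 2 / d

theorem powerSpectrum_nonneg (v : ZMod d → ℝ) (k : ZMod d) : 0 ≤ powerSpectrum v k := by
  unfold powerSpectrum; positivity

/-- The Wiener–Khinchin identity: expanding the square and summing over k leaves, by orthogonality
of characters, only b = a + n. -/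
theorem autocorr_eq_sum (v : ZMod d → ℝ) (n : ZMod d) :
    (autocorr v n : ℂ) = ∑ k, (powerSpectrum v k : ℂ) * stdAddChar (k * n) := by
  have hd : (d : ℂ) ≠ 0 := Nat.cast_ne_zero.mpr (NeZero.ne d)
  have h1 : ∀ k, (powerSpectrum v k : ℂ) * stdAddChar (k * n) =
      (∑ a, ∑ b, (v a : ℂ) * v b * stdAddChar (k * (a - b + n))) / d := by
    intro k
    rw [powerSpectrum]
    push_cast
    rw [← Complex.mul_conj', map_sum, Finset.sum_mul_sum, div_mul_eq_mul_div, Finset.sum_mul]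
    congr 1
    refine Finset.sum_congr rfl fun a _ => ?_
    rw [Finset.sum_mul]
    refine Finset.sum_congr rfl fun b _ => ?_
    rw [_root_.map_mul (starRingEnd ℂ), Complex.conj_ofReal, ← AddChar.map_neg_eq_conj,
      show k * (a - b + n) = k * a + -(k * b) + k * n by ring, AddChar.map_add_eq_mul,
      AddChar.map_add_eq_mul]
    ring
  simp only [h1]
  rw [← Finset.sum_div, Finset.sum_comm]
  have h2 : ∀ a, ∑ k, ∑ b, (v a : ℂ) * v b * stdAddChar (k * (a - b + n)) =
      d * (v a * v (a + n)) := by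
    intro a
    rw [Finset.sum_comm]
    simp only [← Finset.mul_sum]
    simp only [AddChar.sum_mulShift _ (ZMod.isPrimitive_stdAddChar d), ZMod.card]
    have : ∀ b, a - b + n = 0 ↔ a + n = b := by
      intro b
      constructor
      · intro h; linear_combination h
      · intro h; linear_combination h
    simp [this]
    ring
  simp only [h2, ← Finset.mul_sum]
  rw [mul_div_cancel_left₀ _ hd, autocorr]
  push_cast
  rfl

/-- A bound for the sums of the powers of `exp (2 π i t / d)` over intervals, for `t ≠ 0`. -/
noncomputable def resWeight (d : ℕ) [NeZero d] (t : ZMod d) : ℝ :=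
  if t = 0 then 0 else 2 / ‖stdAddChar t - 1‖

theorem resWeight_nonneg (t : ZMod d) : 0 ≤ resWeight d t := by
  unfold resWeight; split_ifs <;> positivity

theorem norm_sum_Ico_stdAddChar_le {t : ZMod d} (ht : t ≠ 0) {a b : ℕ} (hab : a ≤ b) :
    ‖∑ e ∈ Ico a b, stdAddChar (t * (e : ZMod d))‖ ≤ resWeight d t := by
  have h1 : ∀ e : ℕ, stdAddChar (t * (e : ZMod d)) = stdAddChar t ^ e := by
    intro e
    rw [← AddChar.map_nsmul_eq_pow, nsmul_eq_mul, mul_comm]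
  have hne : stdAddChar t ≠ 1 := by
    intro h
    apply ht
    apply ZMod.injective_stdAddChar
    rw [h, AddChar.map_zero_eq_one]
  simp only [h1]
  rw [geom_sum_Ico hne hab, norm_div, resWeight, if_neg ht]
  gcongr
  calc _ ≤ ‖stdAddChar t ^ b‖ + ‖stdAddChar t ^ a‖ := norm_sub_le _ _
    _ = 2 := by rw [norm_pow, norm_pow, AddChar.norm_apply]; norm_num

/-- The error in replacing a sum of `autocorr v` over multiples of `s` by its mean. -/
noncomputable def resError (v : ZMod d → ℝ) (s : ZMod d) : ℝ :=
  ∑ k, powerSpectrum v k * resWeight d (k * s)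

theorem resError_nonneg (v : ZMod d → ℝ) (s : ZMod d) : 0 ≤ resError v s :=
  Finset.sum_nonneg fun _ _ => mul_nonneg (powerSpectrum_nonneg _ _) (resWeight_nonneg _)

theorem sum_powerSpectrum (v : ZMod d → ℝ) : ∑ k, powerSpectrum v k = autocorr v 0 := by
  have := autocorr_eq_sum v 0
  simp only [mul_zero, AddChar.map_zero_eq_one, mul_one] at this
  exact_mod_cast this.symm

theorem sum_autocorr_mul (v : ZMod d → ℝ) (s : ZMod d) :
    ∑ e : ZMod d, autocorr v (s * e) = d * ∑ k with k * s = 0, powerSpectrum v k := by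
  have : ((∑ e : ZMod d, autocorr v (s * e) : ℝ) : ℂ) =
      ((d * ∑ k with k * s = 0, powerSpectrum v k : ℝ) : ℂ) := by
    push_cast
    simp only [autocorr_eq_sum]
    rw [Finset.sum_comm, Finset.sum_filter, Finset.mul_sum]
    refine Finset.sum_congr rfl fun k _ => ?_
    rw [← Finset.mul_sum]
    have : ∀ e : ZMod d, k * (s * e) = e * (k * s) := fun e => by ring
    simp only [this, AddChar.sum_mulShift _ (ZMod.isPrimitive_stdAddChar d), ZMod.card]
    split_ifs <;> simp [mul_comm]
  exact_mod_cast this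

/-- Subtracting the mean removes exactly the frequencies with ks = 0. Every other frequency
contributes a nontrivial geometric sum, bounded by `resWeight` uniformly in the interval, with a
nonnegative coefficient. -/
theorem abs_sum_autocorr_sub_le (v : ZMod d → ℝ) (s : ZMod d) {a b : ℕ} (hab : a ≤ b) :
    |∑ e ∈ Ico a b, autocorr v (s * e) -
      ((b : ℝ) - a) * ((∑ e : ZMod d, autocorr v (s * e)) / d)| ≤ resError v s := by
  have hd : (d : ℝ) ≠ 0 := Nat.cast_ne_zero.mpr (NeZero.ne d)
  rw [sum_autocorr_mul, mul_div_cancel_left₀ _ hd]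
  have key : ((∑ e ∈ Ico a b, autocorr v (s * e) -
      ((b : ℝ) - a) * ∑ k with k * s = 0, powerSpectrum v k : ℝ) : ℂ) =
      ∑ k with k * s ≠ 0, (powerSpectrum v k : ℂ) * ∑ e ∈ Ico a b, stdAddChar (k * s * (e : ZMod d)) := by
    push_cast
    simp only [autocorr_eq_sum]
    rw [Finset.sum_comm, ← Finset.sum_filter_add_sum_filter_not univ (fun k => k * s = 0),
      Finset.mul_sum]
    have : ∑ k with k * s = 0, ∑ e ∈ Ico a b, (powerSpectrum v k : ℂ) * stdAddChar (k * (s * (e : ZMod d))) =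
        ∑ k with k * s = 0, ((b : ℂ) - a) * powerSpectrum v k := by
      refine Finset.sum_congr rfl fun k hk => ?_
      simp only [mem_filter, mem_univ, true_and] at hk
      simp only [← mul_assoc, hk, zero_mul, AddChar.map_zero_eq_one, mul_one, Finset.sum_const,
        Nat.card_Ico, nsmul_eq_mul, Nat.cast_sub hab]
    rw [this, add_sub_cancel_left]
    refine Finset.sum_congr rfl fun k _ => ?_
    rw [Finset.mul_sum]
    simp only [mul_assoc]
  rw [← Real.norm_eq_abs, ← Complex.norm_real, key]
  refine (norm_sum_le _ _).trans ?_
  rw [resError, ← Finset.sum_filter_add_sum_filter_not univ (fun k => k * s = 0)]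
  refine le_add_of_nonneg_of_le (Finset.sum_nonneg fun _ _ =>
    mul_nonneg (powerSpectrum_nonneg _ _) (resWeight_nonneg _)) ?_
  refine Finset.sum_le_sum fun k hk => ?_
  simp only [mem_filter, mem_univ, true_and] at hk
  rw [norm_mul, Complex.norm_real, Real.norm_of_nonneg (powerSpectrum_nonneg _ _)]
  exact mul_le_mul_of_nonneg_left (norm_sum_Ico_stdAddChar_le hk hab) (powerSpectrum_nonneg _ _)

end Fourier

/-! ### Averaging over residues and mean values -/

theorem sum_range_mul_of_periodic {c : ℕ} {G : ℕ → ℝ} (h : Function.Periodic G c) (g : ℕ) :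
    ∑ e ∈ range (g * c), G e = g * ∑ e ∈ range c, G e := by
  induction g with
  | zero => simp
  | succ g ih =>
    have : ∀ i, G (g * c + i) = G i := fun i => by
      rw [add_comm]; exact h.nat_mul g i
    rw [add_mul, one_mul, Finset.sum_range_add, ih]
    simp only [this]
    push_cast
    ring

/-- Multiplication by s covers each multiple of g = gcd(d, s) exactly g times, because s/g is a unit
modulo d/g. -/
theorem sum_zmod_natCast_mul {d : ℕ} [NeZero d] (s : ℕ) (F : ZMod d → ℝ) :
    ∑ e : ZMod d, F (s * e) =
      (d.gcd s : ℝ) * ∑ j ∈ range (d / d.gcd s), F ((d.gcd s * j : ℕ) : ZMod d) := by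
  set g := d.gcd s with hg
  have hgpos : 0 < g := Nat.gcd_pos_of_pos_left _ (NeZero.pos d)
  obtain ⟨c, s', hcop, hc, hs⟩ := Nat.exists_coprime d s
  rw [← hg] at hc hs
  have hdc : d / g = c := by
    rw [hc]; exact Nat.mul_div_cancel _ hgpos
  have : NeZero c := ⟨by rintro rfl; exact NeZero.ne d (by simpa using hc)⟩
  have hcd : ((g * c : ℕ) : ZMod d) = 0 := by
    rw [mul_comm, ← hc, ZMod.natCast_self]
  have hFmod : ∀ n : ℕ, F ((g * (n % c) : ℕ) : ZMod d) = F ((g * n : ℕ) : ZMod d) := by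
    intro n
    congr 1
    conv_rhs => rw [← Nat.mod_add_div n c, mul_add, ← mul_assoc, Nat.cast_add, Nat.cast_mul (g * c),
      hcd, zero_mul, add_zero]
  rw [hdc, ← sum_range_natCast_zmod (fun e : ZMod d => F (s * e))]
  have h1 : ∀ e : ℕ, F ((s : ZMod d) * (e : ZMod d)) = F ((g * ((s' * e) % c) : ℕ) : ZMod d) := by
    intro e
    rw [hFmod, ← Nat.cast_mul, hs]
    congr 2
    ring
  simp only [h1]
  have hper : Function.Periodic (fun e => F ((g * ((s' * e) % c) : ℕ) : ZMod d)) c := by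
    intro e
    simp only [mul_add, Nat.add_mul_mod_self_right]
  have h2 := sum_range_mul_of_periodic hper g
  rw [mul_comm g c, ← hc] at h2
  rw [h2]
  congr 1
  have h3 : ∀ e : ℕ, (s' * e) % c = ((s' : ZMod c) * (e : ZMod c)).val := by
    intro e; rw [← Nat.cast_mul, ZMod.val_natCast]
  simp only [h3]
  rw [sum_range_natCast_zmod (fun e : ZMod c => F ((g * ((s' : ZMod c) * e).val : ℕ) : ZMod d))]
  obtain ⟨u, hu⟩ := (ZMod.isUnit_iff_coprime s' c).mpr hcop.symm
  have h4 := Equiv.sum_comp (Units.mulLeft u) (fun e : ZMod c => F ((g * e.val : ℕ) : ZMod d))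
  simp only [Units.mulLeft_apply, hu] at h4
  rw [h4, ← sum_range_natCast_zmod]
  refine Finset.sum_congr rfl fun j _ => ?_
  rw [ZMod.val_natCast, hFmod]

/-- Jordan's inequality sin(πt) ≥ 2t for t ≤ 1/2, applied to whichever of θ and 1 - θ is smaller.
Keeping both reciprocals makes the bound symmetric, ready for summation. -/
theorem one_div_abs_sin_le {θ : ℝ} (h0 : 0 < θ) (h1 : θ < 1) :
    1 / |Real.sin (Real.pi * θ)| ≤ (1 / θ + 1 / (1 - θ)) / 2 := by
  have key : ∀ t : ℝ, 0 < t → t ≤ 1 / 2 → 2 * t ≤ |Real.sin (Real.pi * t)| := by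
    intro t ht0 ht1
    have := Real.mul_le_sin (x := Real.pi * t) (by positivity)
      (by nlinarith [Real.pi_pos])
    refine le_trans (le_of_eq ?_) (this.trans (le_abs_self _))
    field_simp
  have h2 : (0 : ℝ) < 1 - θ := by linarith
  rcases le_or_gt θ (1 / 2) with h | h
  · calc _ ≤ 1 / (2 * θ) := one_div_le_one_div_of_le (by positivity) (key θ h0 h)
      _ = (1 / θ) / 2 := by field_simp
      _ ≤ _ := by gcongr; linarith [one_div_pos.mpr h2]
  · have h3 := key (1 - θ) h2 (by linarith)
    rw [show Real.pi * (1 - θ) = Real.pi - Real.pi * θ by ring, Real.sin_pi_sub] at h3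
    calc _ ≤ 1 / (2 * (1 - θ)) := one_div_le_one_div_of_le (by positivity) h3
      _ = (1 / (1 - θ)) / 2 := by field_simp
      _ ≤ _ := by gcongr; linarith [one_div_pos.mpr h0]

section
variable {d : ℕ} [NeZero d]
open ZMod (stdAddChar)

theorem resWeight_natCast_le {g c j : ℕ} (hd : d = g * c) (hj0 : 0 < j) (hjc : j < c) :
    resWeight d ((g * j : ℕ) : ZMod d) ≤ (c : ℝ) / 2 * (1 / j + 1 / (c - j : ℕ)) := by
  have hj : (0 : ℝ) < j := by exact_mod_cast hj0
  have hjc' : (j : ℝ) < c := by exact_mod_cast hjc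
  have hg : (g : ℝ) ≠ 0 := by
    rintro h
    have : g = 0 := by exact_mod_cast h
    exact NeZero.ne d (by rw [hd, this, zero_mul])
  have hc : (0 : ℝ) < c := hj.trans hjc'
  rw [resWeight]
  split_ifs with h
  · positivity
  have h1 : stdAddChar ((g * j : ℕ) : ZMod d) = Complex.exp (Complex.I * (2 * (Real.pi * (j / c)) : ℝ)) := by
    have := ZMod.stdAddChar_coe (N := d) ((g * j : ℕ) : ℤ)
    rw [Int.cast_natCast] at this
    rw [this, hd]
    congr 1
    have hg' : (g : ℂ) ≠ 0 := by exact_mod_cast hg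
    have hc' : (c : ℂ) ≠ 0 := by exact_mod_cast hc.ne'
    push_cast
    field_simp
  rw [h1, Complex.norm_exp_I_mul_ofReal_sub_one, mul_div_cancel_left₀ _ two_ne_zero, norm_mul,
    Real.norm_eq_abs, Real.norm_eq_abs, abs_two, ← div_div, div_self two_ne_zero]
  refine (one_div_abs_sin_le (by positivity) (by rwa [div_lt_one hc])).trans_eq ?_
  rw [Nat.cast_sub hjc.le]
  have : (c : ℝ) - j ≠ 0 := by linarith
  field_simp

/-- As s varies, ks runs g times over the multiples of g = gcd(d, k), and the weights |exp(2πij/c) -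
1|⁻¹ with c = d/g sum to a harmonic series. The bound does not depend on k. -/
theorem sum_resWeight_mul_le (k : ZMod d) :
    ∑ s : ZMod d, resWeight d (k * s) ≤ d * (1 + Real.log d) := by
  have h1 := sum_zmod_natCast_mul k.val (resWeight d)
  rw [ZMod.natCast_zmod_val] at h1
  rw [h1]
  set g := d.gcd k.val with hg
  obtain ⟨c, hc⟩ : g ∣ d := Nat.gcd_dvd_left _ _
  have hgpos : 0 < g := Nat.gcd_pos_of_pos_left _ (NeZero.pos d)
  have hdc : d / g = c := by rw [hc]; exact Nat.mul_div_cancel_left _ hgpos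
  have hcpos : 0 < c := Nat.pos_of_ne_zero (by rintro rfl; exact NeZero.ne d (by simpa using hc))
  rw [hdc, Finset.range_eq_Ico, Finset.sum_eq_sum_Ico_succ_bot hcpos]
  have h0 : resWeight d ((g * 0 : ℕ) : ZMod d) = 0 := by simp [resWeight]
  rw [h0, zero_add, zero_add]
  have h2 : ∑ j ∈ Ico 1 c, resWeight d ((g * j : ℕ) : ZMod d) ≤
      ∑ j ∈ Ico 1 c, (c : ℝ) / 2 * (1 / j + 1 / (c - j : ℕ)) :=
    Finset.sum_le_sum fun j hj => by
      rw [Finset.mem_Ico] at hj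
      exact resWeight_natCast_le hc (by omega) hj.2
  have h3 : ∑ j ∈ Ico 1 c, (1 : ℝ) / (c - j : ℕ) = ∑ j ∈ Ico 1 c, (1 : ℝ) / j :=
    Finset.sum_nbij' (fun j => c - j) (fun j => c - j)
      (by intro j; simp only [Finset.mem_Ico]; omega) (by intro j; simp only [Finset.mem_Ico]; omega)
      (by intro j; simp only [Finset.mem_Ico]; omega) (by intro j; simp only [Finset.mem_Ico]; omega)
      (by intro j _; rfl)
  have h4 : ∑ j ∈ Ico 1 c, (1 : ℝ) / j ≤ 1 + Real.log c := by
    refine le_trans ?_ (harmonic_le_one_add_log c)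
    rw [harmonic_eq_sum_Icc]
    push_cast
    simp only [one_div]
    exact Finset.sum_le_sum_of_subset_of_nonneg
      (fun j => by simp only [Finset.mem_Ico, Finset.mem_Icc]; omega) fun _ _ _ => by positivity
  rw [← Finset.mul_sum, Finset.sum_add_distrib, h3] at h2
  have hcd : Real.log c ≤ Real.log d := by
    refine Real.log_le_log (by exact_mod_cast hcpos) ?_
    exact_mod_cast Nat.le_of_dvd (NeZero.pos d) ⟨g, by rw [hc]; ring⟩
  calc (g : ℝ) * ∑ j ∈ Ico 1 c, resWeight d ((g * j : ℕ) : ZMod d)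
      ≤ g * (c * (1 + Real.log d)) := by
        gcongr
        refine h2.trans ?_
        have : (0 : ℝ) ≤ c := Nat.cast_nonneg c
        nlinarith
    _ = d * (1 + Real.log d) := by
        have : (d : ℝ) = g * c := by exact_mod_cast hc
        rw [← mul_assoc, ← this]

/-- The previous bound is uniform in the frequency, so only the total spectral mass `autocorr v 0`
matters. -/
theorem sum_resError_le (v : ZMod d → ℝ) :
    ∑ s : ZMod d, resError v s ≤ autocorr v 0 * (d * (1 + Real.log d)) := by
  simp only [resError]
  rw [Finset.sum_comm, ← sum_powerSpectrum, Finset.sum_mul]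
  simp only [← Finset.mul_sum]
  exact Finset.sum_le_sum fun k _ =>
    mul_le_mul_of_nonneg_left (sum_resWeight_mul_le k) (powerSpectrum_nonneg _ _)

theorem sum_range_mul_eq_sum_sum {M : Type*} [AddCommMonoid M] (G : ℕ → M) (g c : ℕ) :
    ∑ a ∈ range (g * c), G a = ∑ x ∈ range g, ∑ j ∈ range c, G (x + g * j) := by
  rw [Finset.sum_comm]
  induction c with
  | zero => simp
  | succ c ih =>
    rw [mul_add, mul_one, Finset.sum_range_add, ih, Finset.sum_range_succ]
    congr 1
    exact Finset.sum_congr rfl fun x _ => by rw [add_comm]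

/-- A multiple of g has exactly one of its c lifts divisible by gc, and a non-multiple has none, so
the indicators modulo d collapse to those modulo g. -/
theorem sum_saw_lift {g c : ℕ} [NeZero g] (hd : d = g * c) (L a : ℕ) :
    ∑ j ∈ range c, saw d L ((a + g * j : ℕ) : ZMod d) = saw g L (a : ZMod g) := by
  have hc : 0 < c := Nat.pos_of_ne_zero (by rintro rfl; exact NeZero.ne d (by simpa using hd))
  have hg : (g : ℝ) ≠ 0 := Nat.cast_ne_zero.mpr (NeZero.ne g)
  have hc' : (c : ℝ) ≠ 0 := by exact_mod_cast hc.ne'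
  simp only [saw_eq]
  rw [Finset.sum_sub_distrib, Finset.sum_comm, Finset.sum_const, card_range, nsmul_eq_mul]
  congr 1
  · rw [hd]; push_cast; field_simp
  refine Finset.sum_congr rfl fun i _ => ?_
  have e1 : ∀ j : ℕ, ((a + g * j : ℕ) : ZMod d) + ((i : ZMod d) + 1) = 0 ↔ g * c ∣ (a + i + 1) + g * j := by
    intro j
    rw [← hd, ← ZMod.natCast_eq_zero_iff]
    push_cast
    ring_nf
  have e2 : (a : ZMod g) + ((i : ZMod g) + 1) = 0 ↔ g ∣ a + i + 1 := by
    rw [← ZMod.natCast_eq_zero_iff]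
    push_cast
    ring_nf
  simp only [e1, e2]
  set y := a + i + 1
  split_ifs with h
  · obtain ⟨q, hq⟩ := h
    have : ∀ j, g * c ∣ y + g * j ↔ c ∣ q + j := by
      intro j
      rw [hq, ← mul_add]
      exact mul_dvd_mul_iff_left (NeZero.ne g)
    simp only [this]
    have : NeZero c := ⟨hc.ne'⟩
    have h5 : ∀ j : ℕ, (if c ∣ q + j then (1 : ℝ) else 0) =
        if (j : ZMod c) = -(q : ZMod c) then 1 else 0 := by
      intro j
      congr 1
      rw [← ZMod.natCast_eq_zero_iff, Nat.cast_add, eq_neg_iff_add_eq_zero, add_comm]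
    simp only [h5]
    rw [sum_range_natCast_zmod (fun x : ZMod c => if x = -(q : ZMod c) then (1 : ℝ) else 0)]
    simp
  · refine Finset.sum_eq_zero fun j _ => if_neg fun hh => h ?_
    exact (Nat.dvd_add_left (dvd_mul_right g j)).mp ((dvd_mul_right g c).trans hh)

/-- Lifting is used twice: the sum over e replaces the second factor by g · saw_g, and then the sum
over a does the same to the first factor. What remains is the variance of saw_g. -/
theorem sum_autocorr_saw_mul (L s : ℕ) :
    ∑ e : ZMod d, autocorr (saw d L) (s * e) = (d.gcd s : ℝ) ^ 2 * fractVar L (d.gcd s) := by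
  set g := d.gcd s with hg
  obtain ⟨c, hc⟩ : g ∣ d := Nat.gcd_dvd_left _ _
  have hgpos : 0 < g := Nat.gcd_pos_of_pos_left _ (NeZero.pos d)
  have : NeZero g := ⟨hgpos.ne'⟩
  have hdc : d / g = c := by
    conv_lhs => rw [hc]
    exact Nat.mul_div_cancel_left _ hgpos
  have h1 : ∀ a : ℕ, ∑ e : ZMod d, saw d L ((a : ZMod d) + s * e) = g * saw g L (a : ZMod g) := by
    intro a
    rw [sum_zmod_natCast_mul s (fun y => saw d L ((a : ZMod d) + y)), ← hg, hdc,
      ← sum_saw_lift hc L a]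
    simp only [Nat.cast_add]
  unfold autocorr
  rw [Finset.sum_comm]
  simp only [← Finset.mul_sum]
  rw [← sum_range_natCast_zmod (fun a : ZMod d => saw d L a * ∑ e : ZMod d, saw d L (a + s * e))]
  simp only [h1]
  have h2 : ∑ a ∈ range (g * c), saw d L (a : ZMod d) * (g * saw g L (a : ZMod g)) =
      ∑ x ∈ range g, g * saw g L (x : ZMod g) ^ 2 := by
    rw [sum_range_mul_eq_sum_sum]
    refine Finset.sum_congr rfl fun x _ => ?_
    have : ∀ j, ((x + g * j : ℕ) : ZMod g) = x := fun j => by simp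
    simp only [this]
    rw [← Finset.sum_mul, sum_saw_lift hc]
    ring
  rw [← hc] at h2
  rw [h2, sum_range_natCast_zmod (fun x : ZMod g => (g : ℝ) * saw g L x ^ 2), ← Finset.mul_sum,
    sum_saw_sq]
  ring

end

/-! ### Correlations of two sawtooth functions -/

/-- The mean over a common period of the product of `saw d L` and `saw e L`. -/
noncomputable def sawCorr (H : ℝ) (d e : ℕ) : ℝ :=
  (d.gcd e : ℝ) ^ 2 * fractVar H (d.gcd e) / (d * e)

theorem sawCorr_comm (H : ℝ) (d e : ℕ) : sawCorr H d e = sawCorr H e d := by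
  rw [sawCorr, sawCorr, Nat.gcd_comm, mul_comm (d : ℝ)]

theorem card_dvd_run_le {e : ℕ} [NeZero e] (N L : ℕ) :
    ∑ t ∈ range L, (if e ∣ N + t then (1 : ℝ) else 0) ≤ L / e + 1 := by
  have h := saw_eq (d := e) L ((N : ZMod e) - 1)
  have h1 : ∀ t : ℕ, ((N : ZMod e) - 1 + ((t : ZMod e) + 1) = 0) ↔ e ∣ N + t := by
    intro t
    rw [← ZMod.natCast_eq_zero_iff]
    push_cast
    ring_nf
  simp only [h1] at h
  have := (abs_le.mp (abs_saw_le L ((N : ZMod e) - 1))).1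
  linarith

/-- This is where the ordering d ≤ e pays: cancellation in saw_d bounds runs by d, which compensates
the density 1/e. -/
theorem mul_min_le {d e L : ℕ} (hd : 0 < d) (h : d ≤ e) : (L : ℝ) / e * min (d : ℝ) L ≤ L := by
  have hd' : (0 : ℝ) < d := by exact_mod_cast hd
  have h' : (d : ℝ) ≤ e := by exact_mod_cast h
  have he : (0 : ℝ) < e := hd'.trans_le h'
  calc (L : ℝ) / e * min (d : ℝ) L ≤ (L : ℝ) / e * e := by
        gcongr; exact (min_le_left _ _).trans h'
    _ = L := by field_simp

section
variable {d e : ℕ} [NeZero d] [NeZero e]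

/-- In the boundary triangle, fix the multiple N + t of e first; the remaining sum is a run of
saw_d, bounded by min(d, L). There are at most L/e + 1 such multiples. -/
theorem abs_saw_edge_le (h : d ≤ e) (N L : ℕ) :
    |∑ i ∈ range L, ∑ n ∈ Ico N (N + (i + 1)),
      saw d L ((n : ZMod d) - ((i : ZMod d) + 1)) * (if e ∣ n then 1 else 0)| ≤ 2 * L := by
  have h1 : ∑ i ∈ range L, ∑ n ∈ Ico N (N + (i + 1)),
      saw d L ((n : ZMod d) - ((i : ZMod d) + 1)) * (if e ∣ n then 1 else 0) =
      ∑ t ∈ range L, (if e ∣ N + t then 1 else 0) * ∑ j ∈ range (L - t),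
        saw d L ((N : ZMod d) - 1 - j) := by
    have a1 : ∀ i, ∑ n ∈ Ico N (N + (i + 1)),
        saw d L ((n : ZMod d) - ((i : ZMod d) + 1)) * (if e ∣ n then 1 else 0) =
        ∑ t ∈ range (i + 1), saw d L (((N + t : ℕ) : ZMod d) - ((i : ZMod d) + 1)) *
          (if e ∣ N + t then 1 else 0) := by
      intro i
      rw [Finset.sum_Ico_eq_sum_range, Nat.add_sub_cancel_left]
    simp only [a1]
    rw [Finset.sum_comm' (t' := range L) (s' := fun t => Ico t L)
      (by intro i t; simp only [mem_range, Finset.mem_Ico]; omega)]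
    refine Finset.sum_congr rfl fun t _ => ?_
    rw [← Finset.sum_mul, mul_comm, Finset.sum_Ico_eq_sum_range]
    congr 1
    refine Finset.sum_congr rfl fun j _ => ?_
    congr 1
    push_cast
    ring
  rw [h1]
  refine (Finset.abs_sum_le_sum_abs _ _).trans ?_
  calc _ ≤ ∑ t ∈ range L, (if e ∣ N + t then (1 : ℝ) else 0) * min (d : ℝ) L := by
        refine Finset.sum_le_sum fun t _ => ?_
        rw [abs_mul, abs_of_nonneg (by split_ifs <;> simp : (0 : ℝ) ≤ if e ∣ N + t then 1 else 0)]
        exact mul_le_mul_of_nonneg_left (abs_sum_saw_run_sub_le _ _ _) (by split_ifs <;> simp)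
    _ ≤ (L / e + 1) * min (d : ℝ) L := by
        rw [← Finset.sum_mul]
        exact mul_le_mul_of_nonneg_right (card_dvd_run_le N L) (by positivity)
    _ ≤ 2 * L := by
        have := mul_min_le (L := L) (NeZero.pos d) h
        have := min_le_right (d : ℝ) L
        linarith

theorem sum_Ico_ite_dvd (N N' : ℕ) (F : ℕ → ℝ) :
    ∑ n ∈ Ico N N', F n * (if e ∣ n then 1 else 0) =
      ∑ k ∈ Ico ((N + e - 1) / e) ((N' + e - 1) / e), F (e * k) := by
  have he := NeZero.pos e
  simp only [mul_ite, mul_one, mul_zero]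
  rw [← Finset.sum_filter]
  have hiff : ∀ M k : ℕ, (M + e - 1) / e ≤ k ↔ M ≤ e * k := by
    intro M k
    rw [← Nat.lt_succ_iff, Nat.div_lt_iff_lt_mul he, Nat.succ_eq_add_one, add_mul, one_mul, mul_comm k]
    omega
  refine (Finset.sum_nbij (fun k => e * k) ?_ ?_ ?_ ?_).symm
  · intro k hk
    rw [Finset.mem_Ico] at hk
    have h2 := hiff N' k
    simp only [mem_filter, Finset.mem_Ico]
    exact ⟨⟨(hiff N k).mp hk.1, by omega⟩, dvd_mul_right e k⟩
  · intro k _ k' _ hkk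
    exact Nat.eq_of_mul_eq_mul_left he hkk
  · intro n hn
    simp only [coe_filter, Set.mem_ofPred_eq, Finset.mem_Ico] at hn
    obtain ⟨⟨h1, h2⟩, k, rfl⟩ := hn
    refine ⟨k, ?_, rfl⟩
    have h3 := hiff N' k
    simp only [coe_Ico, Set.mem_Ico]
    exact ⟨(hiff N k).mpr h1, by omega⟩
  · intro k _; rfl

theorem abs_ceil_sub_le (N N' : ℕ) :
    |(((N' + e - 1) / e : ℕ) : ℝ) - ((N + e - 1) / e : ℕ) - ((N' : ℝ) - N) / e| ≤ 1 := by
  have he := NeZero.pos e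
  have he' : (0 : ℝ) < e := by exact_mod_cast he
  have key : ∀ M : ℕ, (M : ℝ) / e ≤ ((M + e - 1) / e : ℕ) ∧
      (((M + e - 1) / e : ℕ) : ℝ) ≤ M / e + 1 := by
    intro M
    have h1 := Nat.div_add_mod (M + e - 1) e
    have h2 := Nat.mod_lt (M + e - 1) he
    set q := (M + e - 1) / e
    constructor
    · rw [div_le_iff₀ he']
      have : M ≤ e * q := by omega
      calc (M : ℝ) ≤ (e * q : ℕ) := by exact_mod_cast this
        _ = q * e := by push_cast; ring
    · rw [div_add_one he'.ne', le_div_iff₀ he']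
      have : e * q ≤ M + e := by omega
      calc (q : ℝ) * e = (e * q : ℕ) := by push_cast; ring
        _ ≤ (M + e : ℕ) := by exact_mod_cast this
        _ = M + e := by push_cast; ring
  have h1 := key N
  have h2 := key N'
  rw [sub_div, abs_le]
  constructor <;> linarith [h1.1, h1.2, h2.1, h2.2]

/-- Replacing saw_e by L/e minus indicators and shifting each window back to [N, N') leaves a sum
over multiples of e of autocorrelations of saw_d. The constant 6 collects 1 for the L/e term, 2 for
each of the two edges, and 1 for rounding the number of multiples of e to (N' - N)/e. -/
theorem abs_sum_saw_mul_saw_sub_le (h : d ≤ e) (L : ℕ) {N N' : ℕ} (hN : N ≤ N') :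
    |∑ a ∈ Ico N N', saw d L a * saw e L a - ((N' : ℝ) - N) * sawCorr L d e| ≤
      6 * L + resError (saw d L) (e : ZMod d) := by
  have hd : (0 : ℝ) < d := Nat.cast_pos.mpr (NeZero.pos d)
  have he : (0 : ℝ) < e := Nat.cast_pos.mpr (NeZero.pos e)
  set K : ℕ → ℕ → ℝ := fun i n => saw d L ((n : ZMod d) - ((i : ZMod d) + 1)) * (if e ∣ n then 1 else 0)
    with hK
  have h1 : ∑ a ∈ Ico N N', saw d L a * saw e L a =
      (L : ℝ) / e * ∑ a ∈ Ico N N', saw d L a -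
        ∑ i ∈ range L, ∑ n ∈ Ico (N + (i + 1)) (N' + (i + 1)), K i n := by
    simp only [saw_eq (d := e), mul_sub, Finset.sum_sub_distrib, Finset.mul_sum]
    congr 1
    · exact Finset.sum_congr rfl fun _ _ => mul_comm _ _
    · rw [Finset.sum_comm]
      refine Finset.sum_congr rfl fun i _ => ?_
      rw [← Finset.sum_Ico_add' (K i) N N' (i + 1)]
      refine Finset.sum_congr rfl fun a _ => ?_
      have : (a : ZMod e) + ((i : ZMod e) + 1) = 0 ↔ e ∣ a + (i + 1) := by
        rw [← ZMod.natCast_eq_zero_iff]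
        push_cast
        rfl
      simp only [hK, this]
      congr 2
      push_cast
      ring
  have h2 : ∀ i, ∑ n ∈ Ico (N + (i + 1)) (N' + (i + 1)), K i n =
      ∑ n ∈ Ico N N', K i n + ∑ n ∈ Ico N' (N' + (i + 1)), K i n -
        ∑ n ∈ Ico N (N + (i + 1)), K i n := by
    intro i
    have e1 := Finset.sum_Ico_consecutive (K i) hN (Nat.le_add_right N' (i + 1))
    have e2 := Finset.sum_Ico_consecutive (K i) (Nat.le_add_right N (i + 1))
      (Nat.add_le_add_right hN (i + 1))
    linarith
  have h3 : ∑ i ∈ range L, ∑ n ∈ Ico N N', K i n =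
      -∑ k ∈ Ico ((N + e - 1) / e) ((N' + e - 1) / e), autocorr (saw d L) ((e : ZMod d) * k) := by
    rw [Finset.sum_comm, ← Finset.sum_neg_distrib]
    have e1 := sum_Ico_ite_dvd (e := e) N N' (fun n => -autocorr (saw d L) (n : ZMod d))
    push_cast at e1
    rw [← e1]
    refine Finset.sum_congr rfl fun n _ => ?_
    rw [autocorr_saw, neg_neg, Finset.sum_mul]
  have h4 := abs_sum_autocorr_sub_le (saw d L) (e : ZMod d)
    (Nat.div_le_div_right (c := e) (show N + e - 1 ≤ N' + e - 1 by omega))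
  rw [sum_autocorr_saw_mul] at h4
  have h5 := abs_saw_edge_le (L := L) h N
  have h6 := abs_saw_edge_le (L := L) h N'
  have h7 : |(L : ℝ) / e * ∑ a ∈ Ico N N', saw d L a| ≤ L := by
    rw [abs_mul, abs_of_nonneg (by positivity : (0 : ℝ) ≤ (L : ℝ) / e)]
    exact (mul_le_mul_of_nonneg_left (abs_sum_Ico_saw_le L N N') (by positivity)).trans
      (mul_min_le (NeZero.pos d) h)
  set g := d.gcd e with hg
  have hgd : (g : ℝ) ≤ d := by exact_mod_cast Nat.gcd_le_left _ (NeZero.pos d)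
  have hgpos : (0 : ℝ) < g := by exact_mod_cast Nat.gcd_pos_of_pos_left _ (NeZero.pos d)
  have hμ0 : 0 ≤ (g : ℝ) ^ 2 * fractVar L g / d := by
    have := fractVar_nonneg L g
    positivity
  have hμ : (g : ℝ) ^ 2 * fractVar L g / d ≤ L := by
    have h8 := fractVar_le L g
    rw [Nat.abs_cast, le_div_iff₀ hgpos] at h8
    rw [div_le_iff₀ hd]
    calc (g : ℝ) ^ 2 * fractVar L g = (fractVar L g * g) * g := by ring
      _ ≤ L * d := by gcongr
  have h9 : |((((N' + e - 1) / e : ℕ) : ℝ) - ((N + e - 1) / e : ℕ) - ((N' : ℝ) - N) / e) *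
      ((g : ℝ) ^ 2 * fractVar L g / d)| ≤ L := by
    rw [abs_mul, abs_of_nonneg hμ0]
    calc _ ≤ 1 * (L : ℝ) := mul_le_mul (abs_ceil_sub_le N N') hμ hμ0 zero_le_one
      _ = L := one_mul _
  have h10 : ((N' : ℝ) - N) / e * ((g : ℝ) ^ 2 * fractVar L g / d) =
      ((N' : ℝ) - N) * sawCorr L d e := by
    rw [sawCorr, ← hg]
    field_simp
  rw [sub_mul, h10] at h9
  simp only [h2, Finset.sum_add_distrib, Finset.sum_sub_distrib] at h1
  rw [h3] at h1
  rw [h1]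
  rw [abs_le] at h4 h5 h6 h7 h9 ⊢
  constructor <;> linarith [h4.1, h4.2, h5.1, h5.2, h6.1, h6.2, h7.1, h7.2, h9.1, h9.2]

omit [NeZero e] in
-- Cut the range into blocks of length d, each a complete residue system; on the block starting at
-- (j + 1)d the denominator is at least (j + 1)d.
theorem sum_Ico_div_le {G : ZMod d → ℝ} (hG : ∀ x, 0 ≤ G x) (D : ℕ) :
    ∑ n ∈ Ico d ((D + 1) * d), G n / n ≤ (∑ x, G x) / d * ∑ j ∈ range D, (1 : ℝ) / (j + 1) := by
  have hd : (0 : ℝ) < d := Nat.cast_pos.mpr (NeZero.pos d)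
  induction D with
  | zero => simp
  | succ D ih =>
    rw [← Finset.sum_Ico_consecutive _ (show d ≤ (D + 1) * d by nlinarith [NeZero.pos d])
      (show (D + 1) * d ≤ (D + 1 + 1) * d by nlinarith [NeZero.pos d]), Finset.sum_range_succ, mul_add]
    refine add_le_add ih ?_
    rw [Finset.sum_Ico_eq_sum_range, ← Nat.sub_mul, Nat.add_sub_cancel_left, one_mul,
      ← sum_range_natCast_zmod, Finset.sum_div, Finset.sum_mul]
    refine Finset.sum_le_sum fun i _ => ?_
    have : (((D + 1) * d + i : ℕ) : ZMod d) = i := by simp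
    rw [this, div_mul_div_comm, mul_one]
    refine div_le_div_of_nonneg_left (hG _) (by positivity) ?_
    push_cast
    nlinarith [(Nat.cast_nonneg i : (0 : ℝ) ≤ i)]

end

theorem sum_range_one_div_le (D : ℕ) : ∑ j ∈ range D, (1 : ℝ) / (j + 1) ≤ 1 + Real.log D := by
  refine le_trans (le_of_eq ?_) (harmonic_le_one_add_log D)
  rw [harmonic]
  push_cast
  simp

/-- The error in replacing a sum of `saw d L * saw e L` by its mean value. -/
noncomputable def sawError (L N N' d e : ℕ) : ℝ :=
  |∑ a ∈ Ico N N', saw d L a * saw e L a - ((N' : ℝ) - N) * sawCorr L d e|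

theorem sawError_comm (L N N' d e : ℕ) : sawError L N N' d e = sawError L N N' e d := by
  rw [sawError, sawError, sawCorr_comm]
  simp only [mul_comm]

/-- The pointwise bound depends on e only through its residue modulo d, so block averaging applies.
Of the constant 7, 6 comes from the elementary terms and 1 from the averaged Fourier error. -/
theorem sum_sawError_div_le (L : ℕ) {N N' : ℕ} (hN : N ≤ N') {d D : ℕ} (hd : 0 < d) (hdD : d ≤ D) :
    ∑ e ∈ Icc d D, sawError L N N' d e / e ≤ 7 * L * (1 + Real.log D) ^ 2 := by
  have : NeZero d := ⟨hd.ne'⟩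
  have hd' : (0 : ℝ) < d := by exact_mod_cast hd
  have hlog : 0 ≤ Real.log D := Real.log_natCast_nonneg D
  set G : ZMod d → ℝ := fun x => 6 * L + resError (saw d L) x with hG
  have hG0 : ∀ x, 0 ≤ G x := fun x => add_nonneg (by positivity) (resError_nonneg _ _)
  have h1 : ∑ e ∈ Icc d D, sawError L N N' d e / e ≤ ∑ e ∈ Icc d D, G e / e := by
    refine Finset.sum_le_sum fun e he => ?_
    rw [Finset.mem_Icc] at he
    have : NeZero e := ⟨by omega⟩
    have := abs_sum_saw_mul_saw_sub_le (d := d) (e := e) he.1 L hN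
    gcongr
    exact this
  have h2 : ∑ e ∈ Icc d D, G e / e ≤ ∑ e ∈ Ico d ((D + 1) * d), G e / e := by
    refine Finset.sum_le_sum_of_subset_of_nonneg (fun e => ?_) fun e _ _ => ?_
    · simp only [Finset.mem_Icc, Finset.mem_Ico]
      rintro ⟨h, h'⟩
      exact ⟨h, by nlinarith⟩
    · have := hG0 (e : ZMod d)
      positivity
  have h3 : ∑ x, G x ≤ d * (7 * L * (1 + Real.log D)) := by
    simp only [hG, Finset.sum_add_distrib, Finset.sum_const, Finset.card_univ, ZMod.card, nsmul_eq_mul]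
    have e1 := sum_resError_le (saw d L)
    have e2 := autocorr_saw_zero_le (d := d) L
    have e3 : Real.log d ≤ Real.log D := Real.log_le_log hd' (by exact_mod_cast hdD)
    have e4 : 0 ≤ Real.log d := Real.log_natCast_nonneg d
    calc _ ≤ (d : ℝ) * (6 * L) + L * (d * (1 + Real.log D)) := by
          refine add_le_add le_rfl (e1.trans ?_)
          gcongr
      _ ≤ _ := by
          have : 0 ≤ (d : ℝ) * L * Real.log D := by positivity
          nlinarith
  refine h1.trans (h2.trans ((sum_Ico_div_le hG0 D).trans ?_))
  calc _ ≤ (d * (7 * L * (1 + Real.log D))) / d * (1 + Real.log D) := by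
        refine mul_le_mul (by gcongr) (sum_range_one_div_le D) (by positivity) (by positivity)
    _ = _ := by field_simp

theorem sum_sum_sawError_div_le (L : ℕ) {N N' : ℕ} (hN : N ≤ N') (D : ℕ) :
    ∑ d ∈ Icc 1 D, ∑ e ∈ Icc 1 D, sawError L N N' d e / (d * e) ≤
      14 * L * (1 + Real.log D) ^ 3 := by
  have hlog : 0 ≤ Real.log D := Real.log_natCast_nonneg D
  set T : ℕ → ℕ → ℝ := fun d e => sawError L N N' d e / (d * e) with hT
  have hT0 : ∀ d e, 0 ≤ T d e := fun d e => by
    have : 0 ≤ sawError L N N' d e := abs_nonneg _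
    simp only [hT]; positivity
  have hTc : ∀ d e, T d e = T e d := fun d e => by
    simp only [hT]; rw [sawError_comm, mul_comm (d : ℝ)]
  have h1 : ∑ d ∈ Icc 1 D, ∑ e ∈ Icc d D, T d e ≤ 7 * L * (1 + Real.log D) ^ 3 := by
    calc _ ≤ ∑ d ∈ Icc 1 D, (1 : ℝ) / d * (7 * L * (1 + Real.log D) ^ 2) := by
          refine Finset.sum_le_sum fun d hd => ?_
          rw [Finset.mem_Icc] at hd
          have e1 : ∑ e ∈ Icc d D, T d e = 1 / d * ∑ e ∈ Icc d D, sawError L N N' d e / e := by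
            rw [Finset.mul_sum]
            refine Finset.sum_congr rfl fun e _ => ?_
            simp only [hT]
            rw [div_mul_div_comm, one_mul]
          rw [e1]
          exact mul_le_mul_of_nonneg_left (sum_sawError_div_le L hN hd.1 hd.2) (by positivity)
      _ ≤ (1 + Real.log D) * (7 * L * (1 + Real.log D) ^ 2) := by
          rw [← Finset.sum_mul]
          refine mul_le_mul_of_nonneg_right ?_ (by positivity)
          refine le_trans (le_of_eq ?_) (harmonic_le_one_add_log D)
          rw [harmonic_eq_sum_Icc]
          push_cast
          simp
      _ = _ := by ring
  have h2 : ∑ d ∈ Icc 1 D, ∑ e ∈ Icc 1 D, T d e ≤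
      ∑ d ∈ Icc 1 D, ∑ e ∈ Icc d D, T d e + ∑ d ∈ Icc 1 D, ∑ e ∈ Icc 1 d, T d e := by
    rw [← Finset.sum_add_distrib]
    refine Finset.sum_le_sum fun d hd => ?_
    rw [Finset.mem_Icc] at hd
    have : Icc 1 D = Icc d D ∪ Icc 1 d := by ext; simp; omega
    rw [this, ← Finset.sum_union_inter]
    exact le_add_of_nonneg_right (Finset.sum_nonneg fun _ _ => hT0 _ _)
  have h3 : ∑ d ∈ Icc 1 D, ∑ e ∈ Icc 1 d, T d e = ∑ d ∈ Icc 1 D, ∑ e ∈ Icc d D, T d e := by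
    rw [Finset.sum_comm' (t' := Icc 1 D) (s' := fun e => Icc e D)
      (by intro i t; simp only [Finset.mem_Icc]; omega)]
    exact Finset.sum_congr rfl fun d _ => Finset.sum_congr rfl fun e _ => hTc _ _
  linarith

/-! ### The mean and variance series and their tails -/

/-- The mean value of `S_m(n) / n`, as a sum. -/
noncomputable def schemmelMass (m : ℕ) : ℝ := ∑' d : ℕ, schemmelCoeff m d / d

/-- The term of index `(d, e)` of the double series for the variance. -/
noncomputable def schemmelPairTerm (m : ℕ) (H : ℝ) (x : ℕ × ℕ) : ℝ :=
  schemmelCoeff m x.1 * schemmelCoeff m x.2 * sawCorr H x.1 x.2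

/-- The variance, as a double series. -/
noncomputable def schemmelVar (m : ℕ) (H : ℝ) : ℝ := ∑' x : ℕ × ℕ, schemmelPairTerm m H x

theorem abs_tsum_sub_sum_le {ι : Type*} {u w : ι → ℝ} {c : ℝ} (hu : Summable u) (hw : Summable w)
    (hw0 : ∀ i, 0 ≤ w i) (hc : 0 ≤ c) (s : Finset ι) (h : ∀ i ∉ s, |u i| ≤ c * w i) :
    |∑' i, u i - ∑ i ∈ s, u i| ≤ c * ∑' i, w i := by
  rw [← hu.sum_add_tsum_compl (s := s), add_sub_cancel_left]
  have hs : Summable fun i : ↑(↑s : Set ι)ᶜ => c * w i := (hw.mul_left c).subtype _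
  refine (tsum_of_norm_bounded (f := fun i : ↑(↑s : Set ι)ᶜ => u i) hs.hasSum fun i => ?_).trans ?_
  · exact h i fun hi => i.2 (Finset.mem_coe.mpr hi)
  · rw [← tsum_mul_left]
    exact Summable.tsum_subtype_le (fun i => c * w i) _ (fun i => mul_nonneg hc (hw0 i))
      (hw.mul_left c)

/-- A summable weight dominating all error terms. -/
noncomputable def errWeight (δ : ℝ) (n : ℕ) : ℝ := (n : ℝ) ^ (-1 - δ)

theorem errWeight_nonneg (δ : ℝ) (n : ℕ) : 0 ≤ errWeight δ n := by unfold errWeight; positivity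

theorem summable_errWeight {δ : ℝ} (hδ : 0 < δ) : Summable (errWeight δ) :=
  Real.summable_nat_rpow.mpr (by linarith)

theorem summable_errWeight_mul {δ : ℝ} (hδ : 0 < δ) :
    Summable fun x : ℕ × ℕ => errWeight δ x.1 * errWeight δ x.2 :=
  (summable_errWeight hδ).mul_of_nonneg (summable_errWeight hδ) (errWeight_nonneg δ)
    (errWeight_nonneg δ)

section
variable {m : ℕ} {C δ : ℝ} (hC : ∀ n : ℕ, n ≠ 0 → |schemmelCoeff m n| ≤ C * (n : ℝ) ^ (δ - 1))
include hC

theorem coeffBound_nonneg : 0 ≤ C := by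
  have := hC 1 one_ne_zero
  simp only [Nat.cast_one, Real.one_rpow, mul_one] at this
  exact (abs_nonneg _).trans this

theorem abs_schemmelCoeff_le_weight (hδ : 0 < δ) {n D : ℕ} (hn : n ∈ Icc 1 D) :
    |schemmelCoeff m n| ≤ C * (D : ℝ) ^ (2 * δ) * errWeight δ n := by
  rw [Finset.mem_Icc] at hn
  have hn0 : (0 : ℝ) < n := by exact_mod_cast hn.1
  have hC0 := coeffBound_nonneg hC
  refine (hC n (by omega)).trans ?_
  rw [errWeight, show δ - 1 = 2 * δ + (-1 - δ) by ring, Real.rpow_add hn0, ← mul_assoc]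
  gcongr
  exact_mod_cast hn.2

theorem abs_schemmelCoeff_le_div (hδ : 0 < δ) {n D : ℕ} (hn : n ∈ Icc 1 D) :
    |schemmelCoeff m n| ≤ C * (D : ℝ) ^ δ / n := by
  rw [Finset.mem_Icc] at hn
  have hn0 : (0 : ℝ) < n := by exact_mod_cast hn.1
  have hC0 := coeffBound_nonneg hC
  refine (hC n (by omega)).trans ?_
  rw [Real.rpow_sub_one hn0.ne', mul_div_assoc]
  gcongr
  exact_mod_cast hn.2

theorem abs_schemmelCoeff_div_le (n : ℕ) :
    |schemmelCoeff m n / n| ≤ C * (n : ℝ) ^ (2 * δ - 1) * errWeight δ n := by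
  rcases Nat.eq_zero_or_pos n with rfl | hn
  · simp only [CharP.cast_eq_zero, div_zero, abs_zero]
    have := coeffBound_nonneg hC
    have := errWeight_nonneg δ 0
    positivity
  have hn0 : (0 : ℝ) < n := by exact_mod_cast hn
  rw [abs_div, Nat.abs_cast, div_le_iff₀ hn0]
  refine (hC n hn.ne').trans_eq ?_
  rw [errWeight, mul_assoc C, ← Real.rpow_add hn0, mul_assoc, ← Real.rpow_add_one hn0.ne']
  ring_nf

theorem summable_schemmelCoeff_div_aux (hδ : 0 < δ) (hδ' : δ ≤ 1 / 4) :
    Summable fun d : ℕ => schemmelCoeff m d / d := by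
  refine ((summable_errWeight hδ).mul_left C).of_norm_bounded fun n => ?_
  rcases Nat.eq_zero_or_pos n with rfl | hn
  · simp only [CharP.cast_eq_zero, div_zero, norm_zero]
    exact mul_nonneg (coeffBound_nonneg hC) (errWeight_nonneg _ _)
  · refine (abs_schemmelCoeff_div_le hC n).trans ?_
    refine mul_le_mul_of_nonneg_right ?_ (errWeight_nonneg _ _)
    exact mul_le_of_le_one_right (coeffBound_nonneg hC)
      (Real.rpow_le_one_of_one_le_of_nonpos (by exact_mod_cast hn) (by linarith))

theorem abs_schemmelMass_sub_le (hδ : 0 < δ) (hδ' : δ ≤ 1 / 4) {D : ℕ} (hD : 1 ≤ D) :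
    |schemmelMass m - ∑ d ∈ Icc 1 D, schemmelCoeff m d / d| ≤
      C * (D : ℝ) ^ (2 * δ - 1) * ∑' n, errWeight δ n := by
  have hC0 := coeffBound_nonneg hC
  have hD0 : (0 : ℝ) < D := by exact_mod_cast hD
  refine abs_tsum_sub_sum_le (summable_schemmelCoeff_div_aux hC hδ hδ') (summable_errWeight hδ)
    (errWeight_nonneg δ) (by positivity) _ fun n hn => ?_
  have hw := errWeight_nonneg δ n
  rcases Nat.eq_zero_or_pos n with rfl | hn0
  · simp only [CharP.cast_eq_zero, div_zero, abs_zero]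
    positivity
  · refine (abs_schemmelCoeff_div_le hC n).trans ?_
    have : D ≤ n := by rw [Finset.mem_Icc] at hn; omega
    refine mul_le_mul_of_nonneg_right (mul_le_mul_of_nonneg_left ?_ hC0) hw
    exact Real.rpow_le_rpow_of_nonpos hD0 (by exact_mod_cast this) (by linarith)

/-- From g · {H/g}(1 - {H/g}) ≤ |H| and g ≤ min(d, e), the correlation is at most |H|/max(d, e). The
decay sits on the larger index, whose power also absorbs the n^(2δ) lost at the smaller one. -/
theorem abs_schemmelPairTerm_le (hδ : 0 < δ) (H : ℝ) (x : ℕ × ℕ) :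
    |schemmelPairTerm m H x| ≤ C ^ 2 * |H| * ((max x.1 x.2 : ℕ) : ℝ) ^ (4 * δ - 1) *
      (errWeight δ x.1 * errWeight δ x.2) := by
  have hC0 := coeffBound_nonneg hC
  have key : ∀ d e : ℕ, d ≤ e → |schemmelPairTerm m H (d, e)| ≤
      C ^ 2 * |H| * (e : ℝ) ^ (4 * δ - 1) * (errWeight δ d * errWeight δ e) := by
    intro d e hde
    rcases Nat.eq_zero_or_pos d with rfl | hd
    · simp only [schemmelPairTerm, schemmelCoeff_zero, zero_mul, abs_zero]
      have := errWeight_nonneg δ 0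
      have := errWeight_nonneg δ e
      positivity
    have he := hd.trans_le hde
    have hd0 : (0 : ℝ) < d := by exact_mod_cast hd
    have he0 : (0 : ℝ) < e := by exact_mod_cast he
    have hde0 : (d : ℝ) ≤ e := by exact_mod_cast hde
    have hg : (0 : ℝ) < d.gcd e := by exact_mod_cast Nat.gcd_pos_of_pos_left _ hd
    have hgd : (d.gcd e : ℝ) ≤ d := by exact_mod_cast Nat.gcd_le_left _ hd
    have h1 : |sawCorr H d e| ≤ |H| / e := by
      have h2 := fractVar_le H (d.gcd e)
      have h3 := fractVar_nonneg H (d.gcd e)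
      rw [le_div_iff₀ hg] at h2
      rw [sawCorr, abs_of_nonneg (by positivity), div_le_div_iff₀ (by positivity) he0]
      calc (d.gcd e : ℝ) ^ 2 * fractVar H (d.gcd e) * e =
            (fractVar H (d.gcd e) * d.gcd e) * (d.gcd e * e) := by ring
        _ ≤ |H| * (d * e) := by gcongr
    rw [schemmelPairTerm, abs_mul, abs_mul]
    calc _ ≤ (C * (d : ℝ) ^ (δ - 1)) * (C * (e : ℝ) ^ (δ - 1)) * (|H| / e) := by
          gcongr
          · exact hC d hd.ne'
          · exact hC e he.ne'
      _ = C ^ 2 * |H| * ((d : ℝ) ^ (2 * δ) * (e : ℝ) ^ (2 * δ - 1)) *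
            (errWeight δ d * errWeight δ e) := by
          have e1 : (d : ℝ) ^ (δ - 1) = (d : ℝ) ^ (2 * δ) * errWeight δ d := by
            rw [errWeight, ← Real.rpow_add hd0]; ring_nf
          have e2 : (e : ℝ) ^ (δ - 1) / e = (e : ℝ) ^ (2 * δ - 1) * errWeight δ e := by
            rw [errWeight, ← Real.rpow_add he0, ← Real.rpow_sub_one he0.ne']; ring_nf
          rw [e1]
          calc _ = C ^ 2 * |H| * ((d : ℝ) ^ (2 * δ) * errWeight δ d) * ((e : ℝ) ^ (δ - 1) / e) := by
                ring
            _ = _ := by rw [e2]; ring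
      _ ≤ _ := by
          have := errWeight_nonneg δ d
          have := errWeight_nonneg δ e
          rw [show 4 * δ - 1 = 2 * δ + (2 * δ - 1) by ring, Real.rpow_add he0 (2 * δ)]
          gcongr
  obtain ⟨d, e⟩ := x
  rcases le_total d e with h | h
  · simpa [max_eq_right h] using key d e h
  · have := key e d h
    have h2 : schemmelPairTerm m H (d, e) = schemmelPairTerm m H (e, d) := by
      simp only [schemmelPairTerm, sawCorr_comm H d e]
      ring
    rw [h2]
    simpa [max_eq_left h, mul_comm (errWeight δ d)] using this

theorem abs_schemmelPairTerm_le' (hδ : 0 < δ) (hδ' : δ ≤ 1 / 4) (H : ℝ) (x : ℕ × ℕ) :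
    |schemmelPairTerm m H x| ≤ C ^ 2 * |H| * (errWeight δ x.1 * errWeight δ x.2) := by
  have hw := mul_nonneg (errWeight_nonneg δ x.1) (errWeight_nonneg δ x.2)
  have hC0 := coeffBound_nonneg hC
  refine (abs_schemmelPairTerm_le hC hδ H x).trans ?_
  refine mul_le_mul_of_nonneg_right (mul_le_of_le_one_right (by positivity) ?_) hw
  rcases Nat.eq_zero_or_pos (max x.1 x.2) with h | h
  · rw [h, Nat.cast_zero]
    exact Real.zero_rpow_le_one _
  · exact Real.rpow_le_one_of_one_le_of_nonpos (by exact_mod_cast h) (by linarith)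

theorem abs_schemmelVar_sub_le (hδ : 0 < δ) (hδ' : δ ≤ 1 / 4) (H : ℝ) {D : ℕ} (hD : 1 ≤ D) :
    |schemmelVar m H - ∑ d ∈ Icc 1 D, ∑ e ∈ Icc 1 D, schemmelPairTerm m H (d, e)| ≤
      C ^ 2 * |H| * (D : ℝ) ^ (4 * δ - 1) * (∑' n, errWeight δ n) ^ 2 := by
  have hC0 := coeffBound_nonneg hC
  have hD0 : (0 : ℝ) < D := by exact_mod_cast hD
  have hs : Summable (schemmelPairTerm m H) :=
    ((summable_errWeight_mul hδ).mul_left _).of_norm_bounded (abs_schemmelPairTerm_le' hC hδ hδ' H)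
  have hsq : (∑' n, errWeight δ n) ^ 2 = ∑' x : ℕ × ℕ, errWeight δ x.1 * errWeight δ x.2 := by
    rw [sq]
    exact (summable_errWeight hδ).tsum_mul_tsum (summable_errWeight hδ) (summable_errWeight_mul hδ)
  rw [hsq, ← Finset.sum_product (Icc 1 D) (Icc 1 D) (schemmelPairTerm m H)]
  refine abs_tsum_sub_sum_le hs (summable_errWeight_mul hδ)
    (fun x => mul_nonneg (errWeight_nonneg δ x.1) (errWeight_nonneg δ x.2)) (by positivity) _
    fun x hx => ?_
  have hw := mul_nonneg (errWeight_nonneg δ x.1) (errWeight_nonneg δ x.2)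
  by_cases h0 : x.1 = 0 ∨ x.2 = 0
  · have : schemmelPairTerm m H x = 0 := by
      rcases h0 with h | h <;> simp [schemmelPairTerm, h, schemmelCoeff_zero]
    rw [this, abs_zero]
    positivity
  · have h1 : D ≤ max x.1 x.2 := by
      simp only [Finset.mem_product, Finset.mem_Icc] at hx
      omega
    refine (abs_schemmelPairTerm_le hC hδ H x).trans ?_
    refine mul_le_mul_of_nonneg_right (mul_le_mul_of_nonneg_left ?_ (by positivity)) hw
    exact Real.rpow_le_rpow_of_nonpos hD0 (by exact_mod_cast h1) (by linarith)

theorem abs_schemmelVar_le (hδ : 0 < δ) (hδ' : δ ≤ 1 / 4) (H : ℝ) :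
    |schemmelVar m H| ≤ C ^ 2 * (∑' n, errWeight δ n) ^ 2 * |H| := by
  have hsq : (∑' n, errWeight δ n) ^ 2 = ∑' x : ℕ × ℕ, errWeight δ x.1 * errWeight δ x.2 := by
    rw [sq]
    exact (summable_errWeight hδ).tsum_mul_tsum (summable_errWeight hδ) (summable_errWeight_mul hδ)
  refine (tsum_of_norm_bounded (f := schemmelPairTerm m H) ((summable_errWeight_mul hδ).mul_left _).hasSum
    (abs_schemmelPairTerm_le' hC hδ hδ' H)).trans_eq ?_
  rw [tsum_mul_left, hsq]
  ring

end

theorem summable_schemmelCoeff_div {m : ℕ} (hm : 1 ≤ m) :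
    Summable fun d : ℕ => schemmelCoeff m d / d := by
  obtain ⟨C, _, hC⟩ := exists_abs_schemmelCoeff_le hm (show (0 : ℝ) < 1 / 4 by norm_num)
  exact summable_schemmelCoeff_div_aux hC (by norm_num) le_rfl

theorem summable_schemmelPairTerm {m : ℕ} (hm : 1 ≤ m) (H : ℝ) : Summable (schemmelPairTerm m H) := by
  obtain ⟨C, _, hC⟩ := exists_abs_schemmelCoeff_le hm (show (0 : ℝ) < 1 / 4 by norm_num)
  exact ((summable_errWeight_mul (by norm_num)).mul_left _).of_norm_bounded
    (abs_schemmelPairTerm_le' hC (by norm_num) le_rfl H)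

/-! ### Second moment for integer lengths -/

/-- The sum of `S_m(n) / n` over `a < n ≤ a + L` with `n` coprime to `P(m)`, minus its mean value. -/
noncomputable def schemmelDisc (m L a : ℕ) : ℝ :=
  ∑ n ∈ Ioc a (a + L), ∑ d ∈ n.divisors, schemmelCoeff m d - schemmelMass m * L

/-- Every divisor of an n ≤ a + L is at most D, so the truncation at D is exact here; a tail enters
only through the mean value. -/
theorem sum_Ioc_divisors_schemmelCoeff (m : ℕ) {L a D : ℕ} (h : a + L ≤ D) :
    ∑ n ∈ Ioc a (a + L), ∑ d ∈ n.divisors, schemmelCoeff m d =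
      ∑ d ∈ Icc 1 D, schemmelCoeff m d * (L / d - saw d L a) := by
  have h1 : ∀ n ∈ Ioc a (a + L), ∑ d ∈ n.divisors, schemmelCoeff m d =
      ∑ d ∈ Icc 1 D, schemmelCoeff m d * if d ∣ n then 1 else 0 := by
    intro n hn
    rw [Finset.mem_Ioc] at hn
    simp only [mul_ite, mul_one, mul_zero]
    rw [← Finset.sum_filter]
    refine Finset.sum_congr ?_ fun _ _ => rfl
    ext d
    simp only [Nat.mem_divisors, mem_filter, Finset.mem_Icc]
    constructor
    · rintro ⟨hd, hn0⟩
      exact ⟨⟨Nat.pos_of_dvd_of_pos hd (by omega), (Nat.le_of_dvd (by omega) hd).trans (by omega)⟩, hd⟩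
    · rintro ⟨_, hd⟩
      exact ⟨hd, by omega⟩
  rw [Finset.sum_congr rfl h1, Finset.sum_comm]
  refine Finset.sum_congr rfl fun d hd => ?_
  rw [Finset.mem_Icc] at hd
  have : NeZero d := ⟨by omega⟩
  rw [← Finset.mul_sum, saw_eq, sub_sub_cancel]
  congr 1
  have h2 : ∀ i : ℕ, (a : ZMod d) + ((i : ZMod d) + 1) = 0 ↔ d ∣ a + (i + 1) := by
    intro i
    rw [← ZMod.natCast_eq_zero_iff]
    push_cast
    rfl
  simp only [h2]
  rw [← Finset.Ico_add_one_add_one_eq_Ioc, Finset.sum_Ico_eq_sum_range,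
    show a + L + 1 - (a + 1) = L by omega]
  exact Finset.sum_congr rfl fun i _ => by rw [add_assoc, add_comm 1 i]

theorem exists_one_add_log_le {δ : ℝ} (hδ : 0 < δ) :
    ∃ c : ℝ, 1 ≤ c ∧ ∀ D : ℕ, 1 ≤ D → 1 + Real.log D ≤ c * (D : ℝ) ^ δ := by
  refine ⟨1 + 1 / δ, by have := one_div_pos.mpr hδ; linarith, fun D hD => ?_⟩
  have h1 : (1 : ℝ) ≤ (D : ℝ) ^ δ := Real.one_le_rpow (by exact_mod_cast hD) hδ.le
  have h2 := Real.log_natCast_le_rpow_div D hδ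
  calc 1 + Real.log D ≤ (D : ℝ) ^ δ + (D : ℝ) ^ δ / δ := add_le_add h1 h2
    _ = _ := by ring

theorem schemmelDisc_eq (m : ℕ) {L a D : ℕ} (h : a + L ≤ D) :
    schemmelDisc m L a = -(∑ d ∈ Icc 1 D, schemmelCoeff m d * saw d L a +
      L * (schemmelMass m - ∑ d ∈ Icc 1 D, schemmelCoeff m d / d)) := by
  rw [schemmelDisc, sum_Ioc_divisors_schemmelCoeff m h]
  simp only [mul_sub, Finset.sum_sub_distrib, Finset.mul_sum]
  have : ∀ d : ℕ, schemmelCoeff m d * ((L : ℝ) / d) = L * (schemmelCoeff m d / d) := fun d => by ring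
  simp only [this]
  ring

theorem abs_sum_coeff_mul_saw_le (m L N N' D : ℕ) :
    |∑ a ∈ Ico N N', ∑ d ∈ Icc 1 D, schemmelCoeff m d * saw d L a| ≤
      L * ∑ d ∈ Icc 1 D, |schemmelCoeff m d| := by
  rw [Finset.sum_comm, Finset.mul_sum]
  refine (Finset.abs_sum_le_sum_abs _ _).trans (Finset.sum_le_sum fun d hd => ?_)
  rw [Finset.mem_Icc] at hd
  have : NeZero d := ⟨by omega⟩
  rw [← Finset.mul_sum, abs_mul, mul_comm]
  exact mul_le_mul_of_nonneg_right ((abs_sum_Ico_saw_le L N N').trans (min_le_right _ _))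
    (abs_nonneg _)

theorem abs_sum_sq_coeff_mul_saw_sub_le {m : ℕ} {C δ : ℝ}
    (hC : ∀ n : ℕ, n ≠ 0 → |schemmelCoeff m n| ≤ C * (n : ℝ) ^ (δ - 1)) (hδ : 0 < δ) (L : ℕ)
    {N N' : ℕ} (hN : N ≤ N') (D : ℕ) :
    |∑ a ∈ Ico N N', (∑ d ∈ Icc 1 D, schemmelCoeff m d * saw d L a) ^ 2 -
      ((N' : ℝ) - N) * ∑ d ∈ Icc 1 D, ∑ e ∈ Icc 1 D, schemmelPairTerm m L (d, e)| ≤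
      (C * (D : ℝ) ^ δ) ^ 2 * (14 * L * (1 + Real.log D) ^ 3) := by
  have hC0 := coeffBound_nonneg hC
  have h1 : ∑ a ∈ Ico N N', (∑ d ∈ Icc 1 D, schemmelCoeff m d * saw d L a) ^ 2 -
      ((N' : ℝ) - N) * ∑ d ∈ Icc 1 D, ∑ e ∈ Icc 1 D, schemmelPairTerm m L (d, e) =
      ∑ d ∈ Icc 1 D, ∑ e ∈ Icc 1 D, schemmelCoeff m d * schemmelCoeff m e *
        (∑ a ∈ Ico N N', saw d L a * saw e L a - ((N' : ℝ) - N) * sawCorr L d e) := by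
    have hsq : ∀ a : ℕ, (∑ d ∈ Icc 1 D, schemmelCoeff m d * saw d L a) ^ 2 =
        ∑ d ∈ Icc 1 D, ∑ e ∈ Icc 1 D,
          schemmelCoeff m d * schemmelCoeff m e * (saw d L a * saw e L a) := by
      intro a
      rw [sq, Finset.sum_mul_sum]
      exact Finset.sum_congr rfl fun d _ => Finset.sum_congr rfl fun e _ => by ring
    simp only [hsq, mul_sub, Finset.sum_sub_distrib, Finset.mul_sum, schemmelPairTerm]
    congr 1
    · rw [Finset.sum_comm]
      exact Finset.sum_congr rfl fun d _ => Finset.sum_comm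
    · refine Finset.sum_congr rfl fun d _ => Finset.sum_congr rfl fun e _ => ?_
      ring
  rw [h1]
  refine (Finset.abs_sum_le_sum_abs _ _).trans ?_
  refine le_trans ?_ (mul_le_mul_of_nonneg_left (sum_sum_sawError_div_le L hN D) (by positivity))
  rw [Finset.mul_sum]
  refine Finset.sum_le_sum fun d hd => ?_
  refine (Finset.abs_sum_le_sum_abs _ _).trans ?_
  rw [Finset.mul_sum]
  refine Finset.sum_le_sum fun e he => ?_
  rw [abs_mul, abs_mul]
  calc _ ≤ (C * (D : ℝ) ^ δ / d) * (C * (D : ℝ) ^ δ / e) * sawError L N N' d e := by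
        refine mul_le_mul_of_nonneg_right ?_ (abs_nonneg _)
        exact mul_le_mul (abs_schemmelCoeff_le_div hC hδ hd) (abs_schemmelCoeff_le_div hC hδ he)
          (abs_nonneg _) (by positivity)
    _ = _ := by ring

/-- The first moment and the pointwise bound are needed besides the second moment: the former for
the cross terms at real lengths, the latter for the fractional ends of [X, 2X]. -/
theorem abs_sum_sq_schemmelDisc_sub_le {m : ℕ} (hm : 1 ≤ m) {δ : ℝ} (hδ : 0 < δ) (hδ' : δ ≤ 1 / 4) :
    ∃ B : ℝ, 0 ≤ B ∧ ∀ L N N' D : ℕ, N ≤ N' → N' + L ≤ D → 1 ≤ D →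
      (∀ a ∈ Icc N N', |schemmelDisc m L a| ≤ B * (D : ℝ) ^ (5 * δ)) ∧
      |∑ a ∈ Ico N N', schemmelDisc m L a| ≤ B * L * (D : ℝ) ^ (5 * δ) ∧
      |∑ a ∈ Ico N N', schemmelDisc m L a ^ 2 - ((N' : ℝ) - N) * schemmelVar m L| ≤
        B * L * (D : ℝ) ^ (5 * δ) := by
  obtain ⟨C, hC1, hC⟩ := exists_abs_schemmelCoeff_le hm hδ
  obtain ⟨c, hc1, hc⟩ := exists_one_add_log_le hδ
  set K := ∑' n, errWeight δ n with hK
  have hK0 : 0 ≤ K := tsum_nonneg (errWeight_nonneg δ)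
  have hC0 : 0 ≤ C := by linarith
  refine ⟨2 * (C * K) + 14 * C ^ 2 * c ^ 3 + 4 * (C * K) ^ 2, by positivity,
    fun L N N' D hN hD hD1 => ?_⟩
  have hD0 : (0 : ℝ) < D := by exact_mod_cast hD1
  set x : ℝ := (D : ℝ) ^ δ with hx
  have hx1 : 1 ≤ x := Real.one_le_rpow (by exact_mod_cast hD1) hδ.le
  have hx0 : 0 ≤ x := by linarith
  have hxp : ∀ k : ℕ, (D : ℝ) ^ (k * δ) = x ^ k := fun k => by
    rw [hx, mul_comm, Real.rpow_mul_natCast hD0.le]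
  have hx5 : (D : ℝ) ^ (5 * δ) = x ^ 5 := by exact_mod_cast hxp 5
  have hx2 : (D : ℝ) ^ (2 * δ) = x ^ 2 := by exact_mod_cast hxp 2
  have hx4 : (D : ℝ) ^ (4 * δ) = x ^ 4 := by exact_mod_cast hxp 4
  have hLD : (L : ℝ) ≤ D := by exact_mod_cast (by omega : L ≤ D)
  have hND : (N' : ℝ) - N ≤ D := by
    have : (N' : ℝ) ≤ D := by exact_mod_cast (by omega : N' ≤ D)
    have : (0 : ℝ) ≤ N := Nat.cast_nonneg _
    linarith
  have hNN : (0 : ℝ) ≤ (N' : ℝ) - N := by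
    have : (N : ℝ) ≤ N' := by exact_mod_cast hN
    linarith
  set G : ℕ → ℝ := fun a => ∑ d ∈ Icc 1 D, schemmelCoeff m d * saw d L a with hG
  set τ : ℝ := schemmelMass m - ∑ d ∈ Icc 1 D, schemmelCoeff m d / d with hτ
  have hE : ∀ a ≤ N', schemmelDisc m L a = -(G a + L * τ) := fun a ha =>
    schemmelDisc_eq m (by omega)
  -- The tail saves a full factor D, enough to pay for L or for N' - N, both at most D.
  have hτb : D * |τ| ≤ C * K * x ^ 2 := by
    have h := abs_schemmelMass_sub_le hC hδ hδ' hD1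
    rw [Real.rpow_sub_one hD0.ne', hx2] at h
    calc D * |τ| ≤ D * (C * (x ^ 2 / D) * K) := by gcongr
      _ = _ := by field_simp
  have hτL : L * |τ| ≤ C * K * x ^ 2 := le_trans (by gcongr) hτb
  have habs : ∑ d ∈ Icc 1 D, |schemmelCoeff m d| ≤ C * K * x ^ 2 := by
    calc _ ≤ ∑ d ∈ Icc 1 D, C * x ^ 2 * errWeight δ d := Finset.sum_le_sum fun d hd => by
          rw [← hx2]; exact abs_schemmelCoeff_le_weight hC hδ hd
      _ ≤ C * x ^ 2 * K := by
          rw [← Finset.mul_sum]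
          gcongr
          exact (summable_errWeight hδ).sum_le_tsum _ fun _ _ => errWeight_nonneg _ _
      _ = _ := by ring
  have hx25 : x ^ 2 ≤ x ^ 5 := pow_le_pow_right₀ hx1 (by norm_num)
  have hx45 : x ^ 4 ≤ x ^ 5 := pow_le_pow_right₀ hx1 (by norm_num)
  have hA : 0 ≤ C * K := by positivity
  have hP : 0 ≤ 14 * C ^ 2 * c ^ 3 := by positivity
  have hQ : 0 ≤ (C * K) ^ 2 := by positivity
  have hGs : |∑ a ∈ Ico N N', G a| ≤ L * (C * K * x ^ 2) :=
    (abs_sum_coeff_mul_saw_le m L N N' D).trans (by gcongr)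
  have hsumτ : ∑ a ∈ Ico N N', ((L : ℝ) * τ) = ((N' : ℝ) - N) * (L * τ) := by
    rw [Finset.sum_const, Nat.card_Ico, nsmul_eq_mul, Nat.cast_sub hN]
  have hNτ : |((N' : ℝ) - N) * (L * τ)| ≤ L * (C * K * x ^ 2) := by
    rw [abs_mul, abs_mul, abs_of_nonneg hNN, Nat.abs_cast]
    calc ((N' : ℝ) - N) * (L * |τ|) ≤ D * (L * |τ|) := by gcongr
      _ = L * (D * |τ|) := by ring
      _ ≤ _ := by gcongr
  have hL0 : (0 : ℝ) ≤ L := Nat.cast_nonneg L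
  rw [hx5]
  refine ⟨fun a ha => ?_, ?_, ?_⟩
  · rw [Finset.mem_Icc] at ha
    rw [hE a ha.2, abs_neg]
    have h1 : |G a| ≤ C * K * x ^ 2 := by
      refine (Finset.abs_sum_le_sum_abs _ _).trans (le_trans (Finset.sum_le_sum fun d hd => ?_) habs)
      rw [Finset.mem_Icc] at hd
      have : NeZero d := ⟨by omega⟩
      rw [abs_mul]
      exact mul_le_of_le_one_right (abs_nonneg _) (abs_saw_le _ _)
    have h2 : |(L : ℝ) * τ| ≤ C * K * x ^ 2 := by rwa [abs_mul, Nat.abs_cast]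
    calc _ ≤ 2 * (C * K) * x ^ 2 := (abs_add_le _ _).trans (by linarith)
      _ ≤ _ := by gcongr; linarith
  · have h1 : ∑ a ∈ Ico N N', schemmelDisc m L a =
        -(∑ a ∈ Ico N N', G a + ((N' : ℝ) - N) * (L * τ)) := by
      rw [← hsumτ, ← Finset.sum_add_distrib, ← Finset.sum_neg_distrib]
      exact Finset.sum_congr rfl fun a ha => hE a (by rw [Finset.mem_Ico] at ha; omega)
    rw [h1, abs_neg]
    calc _ ≤ 2 * (C * K) * L * x ^ 2 := (abs_add_le _ _).trans (by linarith)
      _ ≤ _ := by gcongr; linarith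
  · have h1 : ∑ a ∈ Ico N N', schemmelDisc m L a ^ 2 =
        ∑ a ∈ Ico N N', G a ^ 2 + 2 * (L * τ) * ∑ a ∈ Ico N N', G a +
          ((N' : ℝ) - N) * (L * τ) * (L * τ) := by
      rw [← hsumτ, Finset.mul_sum, Finset.sum_mul, ← Finset.sum_add_distrib, ← Finset.sum_add_distrib]
      refine Finset.sum_congr rfl fun a ha => ?_
      rw [hE a (by rw [Finset.mem_Ico] at ha; omega)]
      ring
    have h2 := abs_sum_sq_coeff_mul_saw_sub_le hC hδ L hN D
    have h3 := abs_schemmelVar_sub_le hC hδ hδ' (L : ℝ) hD1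
    set S := ∑ d ∈ Icc 1 D, ∑ e ∈ Icc 1 D, schemmelPairTerm m L (d, e) with hS
    have h2' : |∑ a ∈ Ico N N', G a ^ 2 - ((N' : ℝ) - N) * S| ≤ 14 * C ^ 2 * c ^ 3 * L * x ^ 5 := by
      refine h2.trans ?_
      calc (C * x) ^ 2 * (14 * L * (1 + Real.log D) ^ 3) ≤ (C * x) ^ 2 * (14 * L * (c * x) ^ 3) := by
            have := Real.log_natCast_nonneg D
            gcongr
            exact hc D hD1
        _ = _ := by ring
    have h3' : |((N' : ℝ) - N) * (schemmelVar m L - S)| ≤ (C * K) ^ 2 * L * x ^ 5 := by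
      rw [abs_mul, abs_of_nonneg hNN]
      rw [Nat.abs_cast, Real.rpow_sub_one hD0.ne', hx4] at h3
      calc _ ≤ D * (C ^ 2 * L * (x ^ 4 / D) * K ^ 2) := by gcongr
        _ = (C * K) ^ 2 * L * x ^ 4 := by field_simp
        _ ≤ _ := by gcongr
    have h4 : |2 * (L * τ) * ∑ a ∈ Ico N N', G a| ≤ 2 * (C * K) ^ 2 * L * x ^ 5 := by
      rw [abs_mul, abs_mul, abs_two, abs_mul, Nat.abs_cast]
      calc _ ≤ 2 * (C * K * x ^ 2) * (L * (C * K * x ^ 2)) := by gcongr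
        _ = 2 * (C * K) ^ 2 * L * x ^ 4 := by ring
        _ ≤ _ := by gcongr
    have h5 : |((N' : ℝ) - N) * (L * τ) * (L * τ)| ≤ (C * K) ^ 2 * L * x ^ 5 := by
      rw [abs_mul]
      calc _ ≤ (L * (C * K * x ^ 2)) * (C * K * x ^ 2) := by
            gcongr
            rwa [abs_mul, Nat.abs_cast]
        _ = (C * K) ^ 2 * L * x ^ 4 := by ring
        _ ≤ _ := by gcongr
    have h6 : 0 ≤ 2 * (C * K) * (L * x ^ 5) := by positivity
    rw [h1]
    rw [abs_le] at h2' h3' h4 h5 ⊢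
    constructor <;> linarith [h2'.1, h2'.2, h3'.1, h3'.2, h4.1, h4.2, h5.1, h5.2]

/-! ### Grouping the double series by the greatest common divisor -/

open Filter Topology

/-- Group by G = A ∩ B: a prime in G contributes x², and a prime outside G lies in neither set or in
exactly one of the two, contributing 1 + 2x. -/
theorem sum_powerset_inter (S : Finset ℕ) (x : ℕ → ℝ) (Ψ : Finset ℕ → ℝ) :
    ∑ A ∈ S.powerset, ∑ B ∈ S.powerset, (∏ p ∈ A, x p) * (∏ p ∈ B, x p) * Ψ (A ∩ B) =
      ∑ G ∈ S.powerset, (∏ p ∈ G, x p) ^ 2 * Ψ G * ∏ p ∈ S \ G, (1 + 2 * x p) := by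
  induction S using Finset.induction_on generalizing Ψ with
  | empty => simp
  | insert q S hq ih =>
    have hA : ∀ A ∈ S.powerset, q ∉ A := fun A hA h => hq (mem_powerset.mp hA h)
    have hp : ∀ A ∈ S.powerset, ∏ p ∈ insert q A, x p = x q * ∏ p ∈ A, x p := fun A h =>
      Finset.prod_insert (hA A h)
    simp only [Finset.sum_powerset_insert hq, Finset.sum_add_distrib]
    have e1 : ∀ A ∈ S.powerset, ∀ B ∈ S.powerset,
        (∏ p ∈ A, x p) * (∏ p ∈ insert q B, x p) * Ψ (A ∩ insert q B) =
          x q * ((∏ p ∈ A, x p) * (∏ p ∈ B, x p) * Ψ (A ∩ B)) := by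
      intro A h B h'
      rw [hp B h', Finset.inter_insert_of_notMem (hA A h)]
      ring
    have e2 : ∀ A ∈ S.powerset, ∀ B ∈ S.powerset,
        (∏ p ∈ insert q A, x p) * (∏ p ∈ B, x p) * Ψ (insert q A ∩ B) =
          x q * ((∏ p ∈ A, x p) * (∏ p ∈ B, x p) * Ψ (A ∩ B)) := by
      intro A h B h'
      rw [hp A h, Finset.insert_inter_of_notMem (hA B h')]
      ring
    have e3 : ∀ A ∈ S.powerset, ∀ B ∈ S.powerset,
        (∏ p ∈ insert q A, x p) * (∏ p ∈ insert q B, x p) * Ψ (insert q A ∩ insert q B) =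
          x q ^ 2 * ((∏ p ∈ A, x p) * (∏ p ∈ B, x p) * Ψ (insert q (A ∩ B))) := by
      intro A h B h'
      rw [hp A h, hp B h', ← Finset.insert_inter_distrib]
      ring
    have r1 : ∀ G ∈ S.powerset, (∏ p ∈ G, x p) ^ 2 * Ψ G * ∏ p ∈ insert q S \ G, (1 + 2 * x p) =
        (1 + 2 * x q) * ((∏ p ∈ G, x p) ^ 2 * Ψ G * ∏ p ∈ S \ G, (1 + 2 * x p)) := by
      intro G h
      rw [Finset.insert_sdiff_of_notMem _ (hA G h), Finset.prod_insert (by simp [hq])]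
      ring
    have r2 : ∀ G ∈ S.powerset, (∏ p ∈ insert q G, x p) ^ 2 * Ψ (insert q G) *
          ∏ p ∈ insert q S \ insert q G, (1 + 2 * x p) =
        x q ^ 2 * ((∏ p ∈ G, x p) ^ 2 * Ψ (insert q G) * ∏ p ∈ S \ G, (1 + 2 * x p)) := by
      intro G h
      have : insert q S \ insert q G = S \ G := by
        ext p
        simp only [Finset.mem_sdiff, Finset.mem_insert]
        constructor
        · rintro ⟨h1, h2⟩; tauto
        · rintro ⟨h1, h2⟩
          exact ⟨Or.inr h1, by rintro (rfl | h3) <;> tauto⟩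
      rw [hp G h, this]
      ring
    rw [Finset.sum_congr rfl r1, Finset.sum_congr rfl r2,
      Finset.sum_congr rfl fun A h => Finset.sum_congr rfl (e1 A h),
      Finset.sum_congr rfl fun A h => Finset.sum_congr rfl (e2 A h),
      Finset.sum_congr rfl fun A h => Finset.sum_congr rfl (e3 A h)]
    simp only [← Finset.mul_sum]
    rw [ih, ih (fun G => Ψ (insert q G))]
    ring

theorem prod_inter_eq_gcd {A B : Finset ℕ} (hA : ∀ p ∈ A, p.Prime) (hB : ∀ p ∈ B, p.Prime) :
    ∏ p ∈ A ∩ B, p = Nat.gcd (∏ p ∈ A, p) (∏ p ∈ B, p) := by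
  have h1 : ∏ p ∈ A, p = (∏ p ∈ A ∩ B, p) * ∏ p ∈ A \ B, p := by
    rw [← Finset.prod_inter_mul_prod_sdiff A B]
  have h2 : ∏ p ∈ B, p = (∏ p ∈ A ∩ B, p) * ∏ p ∈ B \ A, p := by
    rw [Finset.inter_comm, ← Finset.prod_inter_mul_prod_sdiff B A]
  have h3 : Nat.Coprime (∏ p ∈ A \ B, p) (∏ p ∈ B \ A, p) := by
    refine Nat.Coprime.prod_left fun p hp => Nat.Coprime.prod_right fun q hq => ?_
    simp only [Finset.mem_sdiff] at hp hq
    rw [Nat.coprime_primes (hA p hp.1) (hB q hq.1)]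
    rintro rfl
    exact hp.2 hq.1
  rw [h1, h2, Nat.gcd_mul_left, h3, mul_one]

theorem dvd_primorial_of_squarefree {d z : ℕ} (hd : Squarefree d) (hz : d ≤ z) : d ∣ primorial z := by
  rw [← Nat.prod_primeFactors_of_squarefree hd, primorial]
  refine Finset.prod_dvd_prod_of_subset _ _ _ fun p hp => ?_
  have := Nat.le_of_mem_primeFactors hp
  simp only [mem_filter, mem_range]
  exact ⟨by omega, Nat.prime_of_mem_primeFactors hp⟩

theorem squarefree_of_schemmelCoeff_ne_zero {m d : ℕ} (h : schemmelCoeff m d ≠ 0) : Squarefree d := by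
  by_contra hd
  exact h (if_neg hd)

/-- Tannery's theorem: each squarefree d divides `primorial z` once z ≥ d, and u dominates the
summands. -/
theorem tendsto_sum_divisors_primorial {u v : ℕ → ℝ} {F : ℕ → ℕ → ℝ} (hu : Summable u)
    (hF : ∀ z d, |F z d| ≤ u d) (hsq : ∀ z d, ¬ Squarefree d → F z d = 0)
    (hv : ∀ d, Tendsto (fun z => F z d) atTop (𝓝 (v d))) :
    Tendsto (fun z => ∑ d ∈ (primorial z).divisors, F z d) atTop (𝓝 (∑' d, v d)) := by
  have h1 : ∀ z, ∑ d ∈ (primorial z).divisors, F z d =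
      ∑' d, if d ∈ (primorial z).divisors then F z d else 0 := by
    intro z
    rw [tsum_eq_sum (s := (primorial z).divisors) fun d hd => if_neg hd]
    exact Finset.sum_congr rfl fun d hd => (if_pos hd).symm
  simp only [h1]
  refine tendsto_tsum_of_dominated_convergence hu (fun d => ?_) (Eventually.of_forall fun z d => ?_)
  · refine (hv d).congr' ?_
    filter_upwards [eventually_ge_atTop d] with z hz
    split_ifs with h
    · rfl
    · refine hsq z d fun hd => h ?_
      rw [Nat.mem_divisors]
      exact ⟨dvd_primorial_of_squarefree hd hz, (primorial_pos z).ne'⟩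
  · split_ifs
    · exact hF z d
    · rw [norm_zero]; exact (abs_nonneg _).trans (hF z d)

theorem tendsto_sum_divisors_primorial_pair {u : ℕ × ℕ → ℝ} (hu : Summable u)
    (hsq : ∀ x, u x ≠ 0 → Squarefree x.1 ∧ Squarefree x.2) :
    Tendsto (fun z => ∑ d ∈ (primorial z).divisors, ∑ e ∈ (primorial z).divisors, u (d, e)) atTop
      (𝓝 (∑' x, u x)) := by
  have h1 : ∀ z, ∑ d ∈ (primorial z).divisors, ∑ e ∈ (primorial z).divisors, u (d, e) =
      ∑' x, if x ∈ (primorial z).divisors ×ˢ (primorial z).divisors then u x else 0 := by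
    intro z
    rw [tsum_eq_sum (s := (primorial z).divisors ×ˢ (primorial z).divisors) fun d hd => if_neg hd,
      Finset.sum_congr rfl fun d hd => if_pos hd, Finset.sum_product]
  simp only [h1]
  refine tendsto_tsum_of_dominated_convergence hu.norm (fun x => ?_)
    (Eventually.of_forall fun z x => ?_)
  · refine tendsto_const_nhds.congr' ?_
    filter_upwards [eventually_ge_atTop x.1, eventually_ge_atTop x.2] with z hz hz'
    split_ifs with h
    · rfl
    · by_contra hne
      have hd := hsq x hne
      apply h
      simp only [Finset.mem_product, Nat.mem_divisors]
      exact ⟨⟨dvd_primorial_of_squarefree hd.1 hz, (primorial_pos z).ne'⟩,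
        dvd_primorial_of_squarefree hd.2 hz', (primorial_pos z).ne'⟩
  · split_ifs
    · exact le_rfl
    · rw [norm_zero]; exact norm_nonneg _

theorem tendsto_prod_primes {F : ℕ → ℝ} (hF : Multipliable fun p : Nat.Primes => F p) :
    Tendsto (fun z => ∏ p ∈ (range (z + 1)).filter Nat.Prime, F p) atTop
      (𝓝 (∏' p : Nat.Primes, F p)) := by
  have h : Tendsto (fun z => (range (z + 1)).subtype Nat.Prime) atTop atTop := by
    refine tendsto_atTop_finset_of_monotone (fun a b hab p => ?_) fun p => ⟨(p : ℕ), ?_⟩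
    · simp only [Finset.mem_subtype, mem_range]; omega
    · simp [Finset.mem_subtype]
  refine (hF.hasProd.comp h).congr fun z => ?_
  exact Finset.prod_subtype_eq_prod_filter F

theorem summable_primes_div_sq (c : ℝ) : Summable fun p : Nat.Primes => c / (p : ℝ) ^ 2 := by
  have : Summable fun n : ℕ => c / (n : ℝ) ^ 2 := by
    simp only [div_eq_mul_inv]
    exact (Real.summable_nat_pow_inv.mpr (by norm_num)).mul_left c
  exact this.comp_injective Nat.Primes.coe_nat_injective

theorem multipliable_of_abs_sub_one_le {f : Nat.Primes → ℝ} {c : ℝ}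
    (h : ∀ p : Nat.Primes, |f p - 1| ≤ c / (p : ℝ) ^ 2) : Multipliable f := by
  have h1 : Summable fun p => ‖f p - 1‖ :=
    (summable_primes_div_sq c).of_nonneg_of_le (fun _ => norm_nonneg _) h
  simpa using multipliable_one_add_of_summable h1

theorem multipliable_schemmelMeanFactor (m : ℕ) : Multipliable (schemmelMeanFactor m) := by
  refine multipliable_of_abs_sub_one_le (c := m) fun p => ?_
  rw [schemmelMeanFactor]
  split_ifs
  · simp; positivity
  · rw [sub_sub_cancel_left, abs_neg, abs_of_nonneg (by positivity)]

theorem multipliable_schemmelVarFactor (m d : ℕ) : Multipliable (schemmelVarFactor m d) := by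
  refine multipliable_of_abs_sub_one_le (c := 2 * m) fun p => ?_
  rw [schemmelVarFactor]
  split_ifs
  · simp; positivity
  · rw [sub_sub_cancel_left, abs_neg, abs_of_nonneg (by positivity)]

theorem tprod_primes_ite_mem (s : Finset ℕ) (hs : ∀ p ∈ s, p.Prime) (F : ℕ → ℝ) :
    (Multipliable fun p : Nat.Primes => if (p : ℕ) ∈ s then F p else 1) ∧
      ∏' p : Nat.Primes, (if (p : ℕ) ∈ s then F p else 1) = ∏ p ∈ s, F p := by
  have h : ∀ p ∉ (s.subtype Nat.Prime : Finset Nat.Primes), (if ((p : Nat.Primes) : ℕ) ∈ s then F p else 1) = 1 :=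
    fun p hp => if_neg fun h => hp (by rw [Finset.mem_subtype]; exact h)
  refine ⟨(hasProd_prod_of_ne_finset_one (β := Nat.Primes) h).multipliable, ?_⟩
  refine (tprod_eq_prod (β := Nat.Primes) h).trans
    ((Finset.prod_subtype_eq_prod_filter (fun p : ℕ => if p ∈ s then F p else 1)).trans ?_)
  rw [Finset.filter_true_of_mem hs]
  exact Finset.prod_congr rfl fun p hp => if_pos hp

/-- The Euler product of ∑ h(d)/d: the partial product over p ≤ z is the sum over divisors of
`primorial z`, and both sides converge. -/
theorem schemmelMean_eq {m : ℕ} (hm : 1 ≤ m) : schemmelMean m = schemmelMass m := by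
  set s := (range (m + 1)).filter Nat.Prime with hs
  have hfac : ∀ p : Nat.Primes, 1 + schemmelLocal m p / p =
      (if (p : ℕ) ∈ s then 1 - 1 / (p : ℝ) else 1) * schemmelMeanFactor m p := by
    intro p
    rw [schemmelMeanFactor, schemmelLocal]
    simp only [hs, mem_filter, mem_range, p.2, and_true, p.2.dvd_primorial_iff, Nat.lt_succ_iff]
    split_ifs <;> ring
  obtain ⟨h1, h2⟩ := tprod_primes_ite_mem s (fun p hp => (mem_filter.mp hp).2)
    (fun p => 1 - 1 / (p : ℝ))
  have hmult : Multipliable fun p : Nat.Primes => 1 + schemmelLocal m p / (p : ℝ) := by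
    simp only [hfac]
    exact h1.mul (multipliable_schemmelMeanFactor m)
  have hlim := tendsto_prod_primes (F := fun p => 1 + schemmelLocal m p / (p : ℝ)) hmult
  have hsum := summable_schemmelCoeff_div hm
  have hlim2 := tendsto_sum_divisors_primorial (u := fun d => |schemmelCoeff m d / d|)
    (v := fun d => schemmelCoeff m d / d) (F := fun _ d => schemmelCoeff m d / d) hsum.abs
    (fun _ _ => le_rfl) (fun _ d hd => by rw [schemmelCoeff, if_neg hd, zero_div])
    (fun d => tendsto_const_nhds)
  have heq : ∀ z, ∑ d ∈ (primorial z).divisors, schemmelCoeff m d / d =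
      ∏ p ∈ (range (z + 1)).filter Nat.Prime, (1 + schemmelLocal m p / p) := by
    intro z
    have := sum_divisors_squarefree_prod (schemmelLocal m) (primorial_pos z).ne'
      (fun d => (d : ℝ)⁻¹)
    rw [primeFactors_primorial] at this
    rw [Finset.prod_one_add]
    refine Eq.trans (Finset.sum_congr rfl fun d _ => div_eq_mul_inv _ _) (this.trans ?_)
    refine Finset.sum_congr rfl fun A _ => ?_
    push_cast
    rw [Finset.prod_div_distrib, div_eq_mul_inv]
  simp only [heq] at hlim2
  rw [schemmelMass, tendsto_nhds_unique hlim2 hlim, schemmelMean, ← h2,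
    ← h1.tprod_mul (multipliable_schemmelMeanFactor m)]
  exact (tprod_congr hfac).symm

theorem sum_divisors_primorial_schemmelPairTerm (m : ℕ) (H : ℝ) (z : ℕ) :
    ∑ d ∈ (primorial z).divisors, ∑ e ∈ (primorial z).divisors, schemmelPairTerm m H (d, e) =
      ∑ g ∈ (primorial z).divisors, schemmelCoeff m g ^ 2 * (fractVar H g *
        ∏ p ∈ (range (z + 1)).filter Nat.Prime,
          if p ∈ g.primeFactors then 1 else 1 + 2 * (schemmelLocal m p / p)) := by
  set Q := primorial z
  have hQ : Q ≠ 0 := (primorial_pos z).ne'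
  set S := Q.primeFactors with hS
  have hSz : (range (z + 1)).filter Nat.Prime = S := (primeFactors_primorial z).symm
  have hprime : ∀ A ∈ S.powerset, ∀ p ∈ A, p.Prime := fun A hA p hp =>
    Nat.prime_of_mem_primeFactors (mem_powerset.mp hA hp)
  have hcast : ∀ A ∈ S.powerset, ((∏ p ∈ A, p : ℕ) : ℝ) ≠ 0 := fun A hA => by
    rw [Nat.cast_ne_zero, Finset.prod_ne_zero_iff]
    exact fun p hp => (hprime A hA p hp).ne_zero
  have hdiv : ∀ A : Finset ℕ, ∏ p ∈ A, schemmelLocal m p / (p : ℝ) =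
      (∏ p ∈ A, schemmelLocal m p) / (∏ p ∈ A, p : ℕ) := fun A => by
    push_cast
    exact Finset.prod_div_distrib ..
  have h1 : ∀ d, ∑ e ∈ Q.divisors, schemmelPairTerm m H (d, e) =
      schemmelCoeff m d * ∑ B ∈ S.powerset, (∏ p ∈ B, schemmelLocal m p) *
        sawCorr H d (∏ p ∈ B, p) := by
    intro d
    rw [← sum_divisors_squarefree_prod (schemmelLocal m) hQ (fun e => sawCorr H d e), Finset.mul_sum]
    exact Finset.sum_congr rfl fun e _ => by rw [schemmelPairTerm, mul_assoc]; rfl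
  simp only [h1]
  have h2 := sum_divisors_squarefree_prod (schemmelLocal m) hQ (fun d =>
    ∑ B ∈ S.powerset, (∏ p ∈ B, schemmelLocal m p) * sawCorr H d (∏ p ∈ B, p))
  refine Eq.trans h2 ?_
  have h3 := sum_powerset_inter S (fun p => schemmelLocal m p / p)
    (fun G => ((∏ p ∈ G, p : ℕ) : ℝ) ^ 2 * fractVar H (∏ p ∈ G, p))
  have h4 : ∀ A ∈ S.powerset, (∏ p ∈ A, schemmelLocal m p) *
      ∑ B ∈ S.powerset, (∏ p ∈ B, schemmelLocal m p) * sawCorr H (∏ p ∈ A, p) (∏ p ∈ B, p) =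
      ∑ B ∈ S.powerset, (∏ p ∈ A, schemmelLocal m p / (p : ℝ)) * (∏ p ∈ B, schemmelLocal m p / (p : ℝ)) *
        (((∏ p ∈ A ∩ B, p : ℕ) : ℝ) ^ 2 * fractVar H (∏ p ∈ A ∩ B, p)) := by
    intro A hA
    rw [Finset.mul_sum]
    refine Finset.sum_congr rfl fun B hB => ?_
    rw [prod_inter_eq_gcd (hprime A hA) (hprime B hB), hdiv, hdiv, sawCorr]
    ring
  rw [Finset.sum_congr rfl h4, h3]
  have h5 := sum_divisors_squarefree_prod (fun p => schemmelLocal m p ^ 2) hQ (fun g => fractVar H g *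
        ∏ p ∈ S, if p ∈ g.primeFactors then 1 else 1 + 2 * (schemmelLocal m p / p))
  rw [hSz]
  refine Eq.trans ?_ (h5.symm.trans ?_)
  · refine Finset.sum_congr rfl fun G hG => ?_
    rw [Nat.primeFactors_prod (hprime G hG), hdiv, Finset.prod_pow]
    have : ∏ p ∈ S, (if p ∈ G then 1 else 1 + 2 * (schemmelLocal m p / (p : ℝ))) =
        ∏ p ∈ S \ G, (1 + 2 * (schemmelLocal m p / (p : ℝ))) := by
      rw [Finset.prod_ite, Finset.prod_const_one, one_mul, Finset.sdiff_eq_filter]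
    rw [this]
    have := hcast G hG
    field_simp
  · refine Finset.sum_congr rfl fun g _ => ?_
    congr 1
    rw [schemmelCoeff]
    split_ifs
    · rw [Finset.prod_pow]
    · simp

/-- The density attached to the greatest common divisor `g` in the double series. -/
noncomputable def gcdFactor (m g : ℕ) (p : Nat.Primes) : ℝ :=
  if (p : ℕ) ∈ g.primeFactors then 1 else 1 + 2 * (schemmelLocal m p / p)

/-- The total contribution of the pairs with greatest common divisor `g` to the double series. -/
noncomputable def gcdTerm (m : ℕ) (H : ℝ) (g : ℕ) : ℝ :=
  schemmelCoeff m g ^ 2 * (fractVar H g * ∏' p, gcdFactor m g p)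

/-- Thus each factor 1 + 2h(p)/p lies in [0, 1], so all partial products are bounded by 1. This
gives the domination needed for the limit, even when the factor at p = 2 vanishes. -/
theorem two_mul_schemmelLocal_div {m : ℕ} {p : ℕ} (hp : p.Prime) :
    -1 ≤ 2 * (schemmelLocal m p / p) ∧ 2 * (schemmelLocal m p / p) ≤ 0 := by
  have hp0 : (2 : ℝ) ≤ p := by exact_mod_cast hp.two_le
  have hp1 : (0 : ℝ) < p := by linarith
  rw [schemmelLocal, ← mul_div_assoc]
  split_ifs with h
  · rw [le_div_iff₀ hp1, div_le_iff₀ hp1]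
    constructor <;> linarith
  · have hmp : (m : ℝ) + 1 ≤ p := by exact_mod_cast (not_le.mp h)
    have hm0 : (0 : ℝ) ≤ m := Nat.cast_nonneg m
    rw [le_div_iff₀ hp1, div_le_iff₀ hp1, neg_div, mul_neg]
    constructor
    · rw [neg_one_mul, neg_le_neg_iff, ← mul_div_assoc, div_le_iff₀ hp1]
      nlinarith
    · rw [zero_mul]
      have : 0 ≤ (m : ℝ) / p := by positivity
      linarith

theorem gcdFactor_eq {m g : ℕ} {t d : ℕ} (hg : g = t * d) (ht : t ∣ primorial m) (hd : d ≠ 0)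
    (hdc : d.Coprime (primorial m)) (p : Nat.Primes) :
    gcdFactor m g p = (if (p : ℕ) ∈ (primorial m).primeFactors.filter (fun p => ¬ p ∣ t) then
      1 - 2 / (p : ℝ) else 1) * schemmelVarFactor m d p := by
  have hP : primorial m ≠ 0 := (primorial_pos m).ne'
  have ht0 : t ≠ 0 := fun h => hP (by rwa [h, zero_dvd_iff] at ht)
  have hmem : (p : ℕ) ∈ g.primeFactors ↔ (p : ℕ) ∣ t ∨ (p : ℕ) ∣ d := by
    rw [hg, Nat.mem_primeFactors_of_ne_zero (mul_ne_zero ht0 hd), p.2.dvd_mul]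
    simp [p.2]
  rw [gcdFactor, schemmelVarFactor, schemmelLocal]
  simp only [hmem, mem_filter, Nat.mem_primeFactors, p.2, true_and, hP, ne_eq, not_false_eq_true,
    and_true, p.2.dvd_mul]
  by_cases hpP : (p : ℕ) ∣ primorial m
  · have hpd : ¬ (p : ℕ) ∣ d := fun h => Nat.not_coprime_of_dvd_of_dvd p.2.one_lt h hpP hdc
    have hpm := p.2.dvd_primorial_iff.mp hpP
    by_cases hpt : (p : ℕ) ∣ t
    · simp [hpP, hpt]
    · simp only [hpP, hpt, hpd, hpm, or_self, if_false, if_true, not_false_eq_true, and_self, or_true]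
      ring
  · have hpt : ¬ (p : ℕ) ∣ t := fun h => hpP (h.trans ht)
    have hpm : ¬ (p : ℕ) ≤ m := fun h => hpP (p.2.dvd_primorial_iff.mpr h)
    by_cases hpd : (p : ℕ) ∣ d
    · simp [hpP, hpd]
    · simp only [hpP, hpt, hpd, hpm, or_self, if_false, false_and]
      ring

theorem multipliable_gcdFactor (m g : ℕ) : Multipliable (gcdFactor m g) := by
  refine multipliable_of_abs_sub_one_le (c := 2 * m * m + 2 * m) fun p => ?_
  have hp0 : (0 : ℝ) < p := by exact_mod_cast p.2.pos
  rw [gcdFactor, schemmelLocal]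
  split_ifs with h1 h2
  · simp; positivity
  · have h3 : ((p : ℕ) : ℝ) ≤ m := by exact_mod_cast h2
    have h4 : (1 : ℝ) ≤ p := by exact_mod_cast p.2.one_le
    rw [add_sub_cancel_left, ← mul_div_assoc, abs_div, abs_of_pos hp0, le_div_iff₀ (by positivity)]
    norm_num
    rw [div_mul_eq_mul_div, div_le_iff₀ hp0]
    nlinarith [mul_le_mul h3 h3 hp0.le (by positivity)]
  · rw [add_sub_cancel_left, neg_div, neg_div, mul_neg, abs_neg, abs_of_nonneg (by positivity), div_div,
      ← sq, ← mul_div_assoc]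
    gcongr
    nlinarith [(Nat.cast_nonneg m : (0 : ℝ) ≤ m)]

theorem abs_prod_gcdFactor_le (m g : ℕ) (S : Finset ℕ) (hS : ∀ p ∈ S, p.Prime) :
    |∏ p ∈ S, (if p ∈ g.primeFactors then 1 else 1 + 2 * (schemmelLocal m p / p) : ℝ)| ≤ 1 := by
  rw [Finset.abs_prod]
  refine Finset.prod_le_one (fun _ _ => abs_nonneg _) fun p hp => ?_
  have := two_mul_schemmelLocal_div (m := m) (hS p hp)
  split_ifs
  · simp
  · rw [abs_le]; constructor <;> linarith

theorem summable_schemmelCoeff_sq_mul_fractVar {m : ℕ} (hm : 1 ≤ m) (H : ℝ) :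
    Summable fun g : ℕ => schemmelCoeff m g ^ 2 * fractVar H g := by
  obtain ⟨C, hC1, hC⟩ := exists_abs_schemmelCoeff_le hm (show (0 : ℝ) < 1 / 4 by norm_num)
  have hs : Summable fun n : ℕ => C ^ 2 * (n : ℝ) ^ (-3 / 2 : ℝ) :=
    (Real.summable_nat_rpow.mpr (by norm_num)).mul_left _
  refine hs.of_norm_bounded fun n => ?_
  have h0 := fractVar_nonneg H n
  rw [Real.norm_of_nonneg (by positivity)]
  rcases Nat.eq_zero_or_pos n with rfl | hn
  · rw [schemmelCoeff_zero]
    simp only [ne_eq, OfNat.ofNat_ne_zero, not_false_eq_true, zero_pow, zero_mul]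
    positivity
  have hn0 : (0 : ℝ) < n := by exact_mod_cast hn
  calc schemmelCoeff m n ^ 2 * fractVar H n ≤ (C * (n : ℝ) ^ ((1 : ℝ) / 4 - 1)) ^ 2 * 1 := by
        rw [← sq_abs]
        gcongr
        · exact hC n hn.ne'
        · exact fractVar_le_one H n
    _ = _ := by
        rw [mul_one, mul_pow, ← Real.rpow_natCast ((n : ℝ) ^ _), ← Real.rpow_mul hn0.le]
        norm_num

theorem tendsto_prod_gcdFactor (m g : ℕ) :
    Tendsto (fun z => ∏ p ∈ (range (z + 1)).filter Nat.Prime,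
        (if p ∈ g.primeFactors then 1 else 1 + 2 * (schemmelLocal m p / p) : ℝ)) atTop
      (𝓝 (∏' p, gcdFactor m g p)) :=
  tendsto_prod_primes (F := fun p => if p ∈ g.primeFactors then 1 else 1 + 2 * (schemmelLocal m p / p))
    (multipliable_gcdFactor m g)

theorem abs_gcdTerm_le (m : ℕ) (H : ℝ) (g : ℕ) :
    |gcdTerm m H g| ≤ schemmelCoeff m g ^ 2 * fractVar H g := by
  have h0 := fractVar_nonneg H g
  have h1 : |∏' p, gcdFactor m g p| ≤ 1 :=
    le_of_tendsto (tendsto_prod_gcdFactor m g).abs (Eventually.of_forall fun z =>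
      abs_prod_gcdFactor_le m g _ fun p hp => (mem_filter.mp hp).2)
  rw [gcdTerm, abs_mul, abs_mul, abs_of_nonneg h0, abs_of_nonneg (sq_nonneg _)]
  exact mul_le_mul_of_nonneg_left (mul_le_of_le_one_right h0 h1) (sq_nonneg _)

theorem summable_gcdTerm {m : ℕ} (hm : 1 ≤ m) (H : ℝ) : Summable (gcdTerm m H) :=
  (summable_schemmelCoeff_sq_mul_fractVar hm H).of_norm_bounded (abs_gcdTerm_le m H)

theorem schemmelVar_eq_tsum_gcdTerm {m : ℕ} (hm : 1 ≤ m) (H : ℝ) :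
    schemmelVar m H = ∑' g, gcdTerm m H g := by
  have h1 := tendsto_sum_divisors_primorial_pair (summable_schemmelPairTerm hm H) fun x hx => by
    rw [schemmelPairTerm] at hx
    exact ⟨squarefree_of_schemmelCoeff_ne_zero (left_ne_zero_of_mul (left_ne_zero_of_mul hx)),
      squarefree_of_schemmelCoeff_ne_zero (right_ne_zero_of_mul (left_ne_zero_of_mul hx))⟩
  simp only [sum_divisors_primorial_schemmelPairTerm] at h1
  refine tendsto_nhds_unique h1 (tendsto_sum_divisors_primorial
    (summable_schemmelCoeff_sq_mul_fractVar hm H) (fun z g => ?_) (fun z g hg => ?_) fun g => ?_)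
  · have h0 := fractVar_nonneg H g
    rw [abs_mul, abs_mul, abs_of_nonneg h0, abs_of_nonneg (sq_nonneg _)]
    exact mul_le_mul_of_nonneg_left (mul_le_of_le_one_right h0
      (abs_prod_gcdFactor_le m g _ fun p hp => (mem_filter.mp hp).2)) (sq_nonneg _)
  · rw [schemmelCoeff, if_neg hg]
    simp
  · exact ((tendsto_prod_gcdFactor m g).const_mul _).const_mul _

theorem schemmelCoeff_mul_sq {m t d : ℕ} (ht : t ∣ primorial m)
    (hdc : d.Coprime (primorial m)) :
    schemmelCoeff m (t * d) ^ 2 = (ArithmeticFunction.moebius d : ℝ) ^ 2 *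
        (m : ℝ) ^ (2 * ArithmeticFunction.cardDistinctFactors d) / (d : ℝ) ^ 2 := by
  have hP : primorial m ≠ 0 := (primorial_pos m).ne'
  have htd : Nat.Coprime t d := (hdc.coprime_dvd_right ht).symm
  have hPsq : Squarefree (primorial m) := squarefree_primorial m
  have htsq : Squarefree t := hPsq.squarefree_of_dvd ht
  by_cases hdsq : Squarefree d
  · have hμ : (ArithmeticFunction.moebius d : ℝ) ^ 2 = 1 := by
      exact_mod_cast ArithmeticFunction.moebius_sq_eq_one_of_squarefree hdsq
    have h1 : (∏ p ∈ t.primeFactors, schemmelLocal m p) ^ 2 = 1 := by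
      rw [← Finset.prod_pow]
      refine Finset.prod_eq_one fun p hp => ?_
      rw [schemmelLocal, if_pos ((Nat.prime_of_mem_primeFactors hp).dvd_primorial_iff.mp
        ((Nat.dvd_of_mem_primeFactors hp).trans ht))]
      norm_num
    have h2 : (∏ p ∈ d.primeFactors, schemmelLocal m p) ^ 2 =
        (m : ℝ) ^ (2 * d.primeFactors.card) / (d : ℝ) ^ 2 := by
      have : ∏ p ∈ d.primeFactors, schemmelLocal m p = ∏ p ∈ d.primeFactors, (-(m : ℝ) / p) := by
        refine Finset.prod_congr rfl fun p hp => ?_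
        rw [schemmelLocal, if_neg]
        intro h
        have hpp := Nat.prime_of_mem_primeFactors hp
        exact Nat.not_coprime_of_dvd_of_dvd hpp.one_lt (Nat.dvd_of_mem_primeFactors hp)
          (hpp.dvd_primorial_iff.mpr h) hdc
      rw [this, Finset.prod_div_distrib, ← Nat.cast_prod, Nat.prod_primeFactors_of_squarefree hdsq,
        Finset.prod_const, div_pow, ← pow_mul, mul_comm _ 2, pow_mul, pow_mul, neg_sq]
    rw [schemmelCoeff, if_pos ((Nat.squarefree_mul htd).mpr ⟨htsq, hdsq⟩), htd.primeFactors_mul,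
      Finset.prod_union htd.disjoint_primeFactors, mul_pow, h1, h2, hμ, one_mul, one_mul]
    rfl
  · rw [schemmelCoeff, if_neg fun h => hdsq (h.squarefree_of_dvd (dvd_mul_left d t)),
      ArithmeticFunction.moebius_eq_zero_of_not_squarefree hdsq]
    simp

theorem schemmelVarTerm_eq (m : ℕ) (H : ℝ) (d : ℕ) :
    schemmelVarTerm m H d = ∑ t ∈ (primorial m).divisors,
      if Nat.Coprime d (primorial m) then gcdTerm m H (t * d) else 0 := by
  rw [schemmelVarTerm]
  rcases Nat.eq_zero_or_pos d with rfl | hd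
  · rw [if_neg (by omega)]
    refine (Finset.sum_eq_zero fun t _ => ?_).symm
    split_ifs
    · rw [mul_zero, gcdTerm, schemmelCoeff_zero]; ring
    · rfl
  by_cases hdc : Nat.Coprime d (primorial m)
  swap
  · rw [if_neg fun h => hdc h.2]
    exact (Finset.sum_eq_zero fun t _ => if_neg hdc).symm
  rw [if_pos ⟨hd, hdc⟩, Finset.mul_sum]
  refine Finset.sum_congr rfl fun t ht => ?_
  have ht := Nat.dvd_of_mem_divisors ht
  rw [if_pos hdc, gcdTerm, schemmelCoeff_mul_sq ht hdc]
  obtain ⟨h1, h2⟩ := tprod_primes_ite_mem ((primorial m).primeFactors.filter (fun p => ¬ p ∣ t))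
    (fun p hp => Nat.prime_of_mem_primeFactors (mem_filter.mp hp).1) (fun p => 1 - 2 / (p : ℝ))
  rw [tprod_congr (gcdFactor_eq rfl ht hd.ne' hdc), h1.tprod_mul (multipliable_schemmelVarFactor m d),
    h2, fractVar]
  push_cast
  ring

theorem coprime_of_gcd_mul_eq {t d P : ℕ} (hsq : Squarefree (t * d)) (h : Nat.gcd (t * d) P = t) :
    Nat.Coprime d P := by
  have htd := Nat.coprime_of_squarefree_mul hsq
  refine Nat.coprime_of_dvd fun p hp hpd hpP => ?_
  have : p ∣ t := h ▸ Nat.dvd_gcd (hpd.mul_left t) hpP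
  exact Nat.not_coprime_of_dvd_of_dvd hp.one_lt this hpd htd

/-- The g with gcd(g, P(m)) = t are multiples td of t; on the squarefree support of the terms this
gcd condition is equivalent to d being coprime to P(m). -/
theorem hasSum_coprime_gcdTerm {m : ℕ} (hm : 1 ≤ m) (H : ℝ) {t : ℕ} (ht : t ∣ primorial m) :
    HasSum (fun d => if Nat.Coprime d (primorial m) then gcdTerm m H (t * d) else 0)
      (∑' g, if Nat.gcd g (primorial m) = t then gcdTerm m H g else 0) := by
  have hP : primorial m ≠ 0 := (primorial_pos m).ne'
  have ht0 : t ≠ 0 := fun h => hP (by rwa [h, zero_dvd_iff] at ht)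
  have hinj : Function.Injective fun d : ℕ => t * d := fun a b h =>
    Nat.eq_of_mul_eq_mul_left (Nat.pos_of_ne_zero ht0) h
  have hs : Summable fun g => if Nat.gcd g (primorial m) = t then gcdTerm m H g else 0 := by
    refine (summable_gcdTerm hm H).norm.of_norm_bounded fun g => ?_
    split_ifs
    · exact le_rfl
    · rw [norm_zero]; exact norm_nonneg _
  have h1 := (hinj.hasSum_iff (f := fun g => if Nat.gcd g (primorial m) = t then gcdTerm m H g else 0)
    (a := ∑' g, if Nat.gcd g (primorial m) = t then gcdTerm m H g else 0) (by
      intro g hg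
      refine if_neg fun h => hg ?_
      obtain ⟨d, hd⟩ : t ∣ g := h ▸ Nat.gcd_dvd_left _ _
      exact ⟨d, hd.symm⟩)).mpr hs.hasSum
  convert h1 using 1
  funext d
  simp only [Function.comp]
  -- Without squarefreeness of td, gcd(td, P(m)) = t would not force coprimality; the offending
  -- terms are zero and are discarded first.
  by_cases h0 : gcdTerm m H (t * d) = 0
  · simp [h0]
  have hsq : Squarefree (t * d) := squarefree_of_schemmelCoeff_ne_zero (m := m) fun h => h0 (by
    rw [gcdTerm, h]; ring)
  by_cases hdc : Nat.Coprime d (primorial m)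
  · rw [if_pos hdc, if_pos]
    rw [Nat.Coprime.gcd_mul_right_cancel t hdc, Nat.gcd_eq_left ht]
  · rw [if_neg hdc, if_neg fun h => hdc (coprime_of_gcd_mul_eq hsq h)]

theorem hasSum_schemmelVarTerm {m : ℕ} (hm : 1 ≤ m) (H : ℝ) :
    HasSum (schemmelVarTerm m H) (schemmelVar m H) := by
  have hP : primorial m ≠ 0 := (primorial_pos m).ne'
  have h1 := hasSum_sum fun t (ht : t ∈ (primorial m).divisors) =>
    hasSum_coprime_gcdTerm hm H (Nat.dvd_of_mem_divisors ht)
  simp only [← schemmelVarTerm_eq] at h1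
  convert h1 using 1
  rw [schemmelVar_eq_tsum_gcdTerm hm, ← Summable.tsum_finsetSum]
  · refine tsum_congr fun g => ?_
    rw [Finset.sum_ite_eq, if_pos]
    rw [Nat.mem_divisors]
    exact ⟨Nat.gcd_dvd_right _ _, hP⟩
  · intro t _
    refine (summable_gcdTerm hm H).norm.of_norm_bounded fun g => ?_
    split_ifs
    · exact le_rfl
    · rw [norm_zero]; exact norm_nonneg _

/-! ### From integer to real lengths -/

/-- No integer lies strictly between n/g and (n + 1)/g, so {y} - {y}² is a parabola with leading
coefficient -1 there and exceeds its chord by θ(1 - θ)/g². If (n + 1)/g is an integer, its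
fractional part jumps to 0, but y - y² vanishes at both 0 and 1. -/
theorem fractVar_interpolate (n : ℕ) {θ : ℝ} (h0 : 0 ≤ θ) (h1 : θ < 1) {g : ℕ} (hg : 0 < g) :
    fractVar (n + θ) g =
      (1 - θ) * fractVar n g + θ * fractVar (n + 1 : ℕ) g + θ * (1 - θ) / (g : ℝ) ^ 2 := by
  have hg0 : (0 : ℝ) < g := by exact_mod_cast hg
  set r := n % g with hr
  have hrg : r < g := Nat.mod_lt _ hg
  have hrg' : (r : ℝ) + 1 ≤ g := by exact_mod_cast hrg
  have hn : (n : ℝ) = g * (n / g : ℕ) + r := by exact_mod_cast (Nat.div_add_mod n g).symm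
  have e1 : Int.fract (((n : ℝ) + θ) / g) = (r + θ) / g := by
    have : ((n : ℝ) + θ) / g = (r + θ) / g + (n / g : ℕ) := by
      rw [hn]; field_simp; ring
    rw [this, Int.fract_add_natCast, Int.fract_eq_self]
    have : (0 : ℝ) ≤ r := Nat.cast_nonneg r
    refine ⟨by positivity, ?_⟩
    rw [div_lt_one hg0]
    linarith
  have e2 : fractVar (n + 1 : ℕ) g = ((r + 1 : ℝ) / g) - ((r + 1 : ℝ) / g) ^ 2 := by
    have : (((n + 1 : ℕ) : ℝ)) / g = (r + 1) / g + (n / g : ℕ) := by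
      push_cast; rw [hn]; field_simp; ring
    rw [fractVar, this, Int.fract_add_natCast]
    rcases eq_or_lt_of_le hrg' with h | h
    · rw [h, div_self hg0.ne', Int.fract_one]; norm_num
    · rw [Int.fract_eq_self.mpr ⟨by positivity, by rwa [div_lt_one hg0]⟩]
  rw [e2, fractVar, fractVar, e1, Int.fract_div_natCast_eq_div_natCast_mod, ← hr]
  field_simp
  ring

/-- The curvature θ(1 - θ)/g² cancels the g² in `sawCorr`, so the correction separates into the
product of two copies of ∑ h(d)/d. -/
theorem schemmelVar_interpolate {m : ℕ} (hm : 1 ≤ m) (n : ℕ) {θ : ℝ} (h0 : 0 ≤ θ) (h1 : θ < 1) :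
    schemmelVar m (n + θ) = (1 - θ) * schemmelVar m n + θ * schemmelVar m (n + 1 : ℕ) +
      θ * (1 - θ) * schemmelMass m ^ 2 := by
  have hterm : ∀ x : ℕ × ℕ, schemmelPairTerm m (n + θ) x = (1 - θ) * schemmelPairTerm m n x +
      θ * schemmelPairTerm m (n + 1 : ℕ) x +
      θ * (1 - θ) * (schemmelCoeff m x.1 / x.1 * (schemmelCoeff m x.2 / x.2)) := by
    rintro ⟨d, e⟩
    simp only [schemmelPairTerm]
    rcases Nat.eq_zero_or_pos d with rfl | hd
    · simp [schemmelCoeff_zero]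
    have hg : 0 < d.gcd e := Nat.gcd_pos_of_pos_left _ hd
    have hg0 : (d.gcd e : ℝ) ≠ 0 := by exact_mod_cast hg.ne'
    simp only [sawCorr]
    rw [fractVar_interpolate n h0 h1 hg, mul_add _ (_ + _), mul_div_cancel₀ _ (pow_ne_zero 2 hg0)]
    ring
  have hs := summable_schemmelCoeff_div hm
  have hs2 := summable_mul_of_summable_norm hs.norm hs.norm
  rw [schemmelVar, tsum_congr hterm, Summable.tsum_add, Summable.tsum_add, tsum_mul_left,
    tsum_mul_left, tsum_mul_left, sq, schemmelMass, hs.tsum_mul_tsum hs hs2]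
  · rfl
  · exact (summable_schemmelPairTerm hm _).mul_left _
  · exact (summable_schemmelPairTerm hm _).mul_left _
  · exact ((summable_schemmelPairTerm hm _).mul_left _).add ((summable_schemmelPairTerm hm _).mul_left _)
  · exact hs2.mul_left _

section
variable {m : ℕ} {H : ℝ}

/-- On [a, a + 1) the start ⌊x⌋ is fixed, and x + H crosses an integer only at x = a + 1 - {H};
before that point the window holds ⌊H⌋ integers, and from it on ⌊H⌋ + 1. -/
theorem schemmelShortSum_sub_of_lt (hm : 1 ≤ m) (hH : 0 ≤ H) {a : ℕ} {x : ℝ} (h1 : (a : ℝ) ≤ x)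
    (h2 : x < a + 1 - (H - ⌊H⌋₊)) :
    schemmelShortSum m H x - schemmelMass m * H =
      schemmelDisc m ⌊H⌋₊ a - schemmelMass m * (H - ⌊H⌋₊) := by
  have hf := Nat.floor_le hH
  have e1 : ⌊x⌋₊ = a := by
    rw [Nat.floor_eq_iff ((Nat.cast_nonneg a).trans h1)]
    exact ⟨h1, by linarith⟩
  have e2 : ⌊x + H⌋₊ = a + ⌊H⌋₊ := by
    rw [Nat.floor_eq_iff (add_nonneg ((Nat.cast_nonneg a).trans h1) hH)]
    push_cast
    constructor <;> linarith
  rw [schemmelShortSum_eq hm, e1, e2, schemmelDisc]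
  ring

theorem schemmelShortSum_sub_of_ge (hm : 1 ≤ m) (hH : 0 ≤ H) {a : ℕ} {x : ℝ}
    (h1 : a + 1 - (H - ⌊H⌋₊) ≤ x) (h2 : x < a + 1) :
    schemmelShortSum m H x - schemmelMass m * H =
      schemmelDisc m (⌊H⌋₊ + 1) a + schemmelMass m * (1 - (H - ⌊H⌋₊)) := by
  have hf := Nat.lt_floor_add_one H
  have hax : (a : ℝ) ≤ x := by linarith
  have e1 : ⌊x⌋₊ = a := by
    rw [Nat.floor_eq_iff ((Nat.cast_nonneg a).trans hax)]
    exact ⟨hax, h2⟩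
  have e2 : ⌊x + H⌋₊ = a + (⌊H⌋₊ + 1) := by
    rw [Nat.floor_eq_iff (add_nonneg ((Nat.cast_nonneg a).trans hax) hH)]
    push_cast
    constructor <;> linarith
  rw [schemmelShortSum_eq hm, e1, e2, schemmelDisc]
  push_cast
  ring

theorem integral_eq_of_eq_on_Ioo {f : ℝ → ℝ} {a b c : ℝ} (hab : a ≤ b)
    (h : ∀ x ∈ Set.Ioo a b, f x = c) :
    IntervalIntegrable f MeasureTheory.volume a b ∧ ∫ x in a..b, f x = (b - a) * c := by
  have h' : Set.EqOn (fun _ => c) f (Set.uIoo a b) := fun x hx => by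
    rw [Set.uIoo_of_le hab] at hx
    exact (h x hx).symm
  refine ⟨(intervalIntegrable_const (c := c)).congr_uIoo h', ?_⟩
  rw [← intervalIntegral.integral_congr_uIoo h', intervalIntegral.integral_const, smul_eq_mul]

theorem integral_unit_schemmelShortSum (hm : 1 ≤ m) (hH : 0 ≤ H) (a : ℕ) :
    IntervalIntegrable (fun x => |schemmelShortSum m H x - schemmelMass m * H| ^ 2)
        MeasureTheory.volume a (a + 1 : ℕ) ∧
      ∫ x in (a : ℝ)..(a + 1 : ℕ), |schemmelShortSum m H x - schemmelMass m * H| ^ 2 =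
        (1 - (H - ⌊H⌋₊)) * (schemmelDisc m ⌊H⌋₊ a - schemmelMass m * (H - ⌊H⌋₊)) ^ 2 +
        (H - ⌊H⌋₊) * (schemmelDisc m (⌊H⌋₊ + 1) a + schemmelMass m * (1 - (H - ⌊H⌋₊))) ^ 2 := by
  have hf := Nat.floor_le hH
  have hf' := Nat.lt_floor_add_one H
  obtain ⟨i1, e1⟩ := integral_eq_of_eq_on_Ioo
    (f := fun x => |schemmelShortSum m H x - schemmelMass m * H| ^ 2) (a := a)
    (b := a + 1 - (H - ⌊H⌋₊)) (by linarith) fun x hx => by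
      rw [schemmelShortSum_sub_of_lt hm hH hx.1.le hx.2, sq_abs]
  obtain ⟨i2, e2⟩ := integral_eq_of_eq_on_Ioo
    (f := fun x => |schemmelShortSum m H x - schemmelMass m * H| ^ 2) (a := a + 1 - (H - ⌊H⌋₊))
    (b := (a + 1 : ℕ)) (by push_cast; linarith) fun x hx => by
      have := hx.2
      push_cast at this
      rw [schemmelShortSum_sub_of_ge hm hH hx.1.le this, sq_abs]
  refine ⟨i1.trans i2, ?_⟩
  rw [← intervalIntegral.integral_add_adjacent_intervals i1 i2, e1, e2]
  push_cast
  ring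

theorem abs_schemmelShortSum_sub_le (hm : 1 ≤ m) (hH : 0 ≤ H) {a : ℕ} {x B : ℝ} (h1 : (a : ℝ) ≤ x)
    (h2 : x < a + 1) (hB : |schemmelDisc m ⌊H⌋₊ a| ≤ B) (hB' : |schemmelDisc m (⌊H⌋₊ + 1) a| ≤ B) :
    |schemmelShortSum m H x - schemmelMass m * H| ≤ B + |schemmelMass m| := by
  have hf := Nat.floor_le hH
  have hf' := Nat.lt_floor_add_one H
  rcases lt_or_ge x (a + 1 - (H - ⌊H⌋₊)) with h | h
  · rw [schemmelShortSum_sub_of_lt hm hH h1 h]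
    refine (abs_sub _ _).trans (add_le_add hB ?_)
    rw [abs_mul]
    refine mul_le_of_le_one_right (abs_nonneg _) ?_
    rw [abs_le]; constructor <;> linarith
  · rw [schemmelShortSum_sub_of_ge hm hH h h2]
    refine (abs_add_le _ _).trans (add_le_add hB' ?_)
    rw [abs_mul]
    refine mul_le_of_le_one_right (abs_nonneg _) ?_
    rw [abs_le]; constructor <;> linarith

theorem abs_schemmelShortSum_le (hH : H ≤ 1) {x : ℝ} (hx : 0 ≤ x) : |schemmelShortSum m H x| ≤ 1 := by
  have h1 : ⌊x + H⌋₊ ≤ ⌊x⌋₊ + 1 := by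
    rw [← Nat.floor_add_one hx]
    exact Nat.floor_le_floor (by linarith)
  rw [schemmelShortSum]
  refine (Finset.abs_sum_le_sum_abs _ _).trans ?_
  refine (Finset.sum_le_card_nsmul _ _ 1 fun n _ => ?_).trans ?_
  · rw [abs_of_nonneg (by positivity)]
    refine div_le_one_of_le₀ ?_ (Nat.cast_nonneg n)
    have : schemmelTotient m n ≤ n := by
      calc _ ≤ (range n).card := Finset.card_filter_le _ _
        _ = n := card_range n
    exact_mod_cast this
  · rw [nsmul_eq_mul, mul_one]
    have : (filter (fun n => n.Coprime (primorial m)) (Ioc ⌊x⌋₊ ⌊x + H⌋₊)).card ≤ 1 :=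
      (Finset.card_filter_le _ _).trans (by rw [Nat.card_Ioc]; omega)
    exact_mod_cast this

end

theorem abs_integral_le_of_length_le_one {f : ℝ → ℝ} {a b c : ℝ} (hab : a ≤ b) (hba : b ≤ a + 1)
    (hc : 0 ≤ c) (h : ∀ x, a ≤ x → x ≤ b → ‖f x‖ ≤ c) : |∫ x in a..b, f x| ≤ c := by
  have h1 : ‖∫ x in a..b, f x‖ ≤ c * |b - a| :=
    intervalIntegral.norm_integral_le_of_norm_le_const fun x hx => by
      rw [Set.uIoc_of_le hab] at hx
      exact h x hx.1.le hx.2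
  refine h1.trans (mul_le_of_le_one_right hc ?_)
  rw [abs_of_nonneg (by linarith)]
  linarith

theorem integral_nat_schemmelShortSum {m : ℕ} {H θ : ℝ} (hm : 1 ≤ m) (hH : 0 ≤ H) {L : ℕ}
    (hL : ⌊H⌋₊ = L) (hθ : H - L = θ) {N N' : ℕ} (hN : N ≤ N') :
    IntervalIntegrable (fun x => |schemmelShortSum m H x - schemmelMass m * H| ^ 2)
        MeasureTheory.volume N N' ∧
      ∫ x in (N : ℝ)..N', |schemmelShortSum m H x - schemmelMass m * H| ^ 2 =
      (1 - θ) * ∑ a ∈ Ico N N', schemmelDisc m L a ^ 2 +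
        θ * ∑ a ∈ Ico N N', schemmelDisc m (L + 1) a ^ 2 -
        2 * schemmelMass m * (θ * (1 - θ)) * ∑ a ∈ Ico N N', schemmelDisc m L a +
        2 * schemmelMass m * (θ * (1 - θ)) * ∑ a ∈ Ico N N', schemmelDisc m (L + 1) a +
        ((N' : ℝ) - N) * (θ * (1 - θ) * schemmelMass m ^ 2) := by
  have hunit := integral_unit_schemmelShortSum (H := H) hm hH
  rw [hL, hθ] at hunit
  refine ⟨IntervalIntegrable.trans_iterate_Ico (a := fun k : ℕ => (k : ℝ)) hN
    fun k _ => (hunit k).1, ?_⟩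
  have e1 := intervalIntegral.sum_integral_adjacent_intervals_Ico (a := fun k : ℕ => (k : ℝ)) hN
    fun k _ => (hunit k).1
  have e2 : ((N' : ℝ) - N) * (θ * (1 - θ) * schemmelMass m ^ 2) =
      ∑ a ∈ Ico N N', θ * (1 - θ) * schemmelMass m ^ 2 := by
    rw [Finset.sum_const, Nat.card_Ico, nsmul_eq_mul, Nat.cast_sub hN]
  rw [← e1, e2, Finset.mul_sum, Finset.mul_sum, Finset.mul_sum, Finset.mul_sum,
    ← Finset.sum_add_distrib, ← Finset.sum_sub_distrib, ← Finset.sum_add_distrib,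
    ← Finset.sum_add_distrib]
  refine Finset.sum_congr rfl fun a _ => ?_
  rw [(hunit a).2]
  ring

/-- Combination of the estimates for the two integer lengths next to a real length. -/
theorem abs_interpolation_error_le {θ M W S₁ S₂ Q₁ Q₂ V₁ V₂ V J : ℝ} (h0 : 0 ≤ θ) (h1 : θ ≤ 1)
    (hS₁ : |S₁| ≤ W) (hS₂ : |S₂| ≤ W) (hQ₁ : |Q₁ - J * V₁| ≤ W) (hQ₂ : |Q₂ - J * V₂| ≤ W)
    (hV : V = (1 - θ) * V₁ + θ * V₂ + θ * (1 - θ) * M ^ 2) :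
    |(1 - θ) * Q₁ + θ * Q₂ - 2 * M * (θ * (1 - θ)) * S₁ + 2 * M * (θ * (1 - θ)) * S₂ +
      J * (θ * (1 - θ) * M ^ 2) - J * V| ≤ (1 + 4 * |M|) * W := by
  have hW0 : 0 ≤ W := (abs_nonneg _).trans hS₁
  have hθθ : 0 ≤ θ * (1 - θ) ∧ θ * (1 - θ) ≤ 1 := by constructor <;> nlinarith
  have key : ∀ S : ℝ, |S| ≤ W → |2 * M * (θ * (1 - θ)) * S| ≤ 2 * |M| * W := by
    intro S hS
    rw [abs_mul, abs_mul, abs_mul, abs_two, abs_of_nonneg hθθ.1]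
    exact mul_le_mul (mul_le_of_le_one_right (by positivity) hθθ.2) hS (abs_nonneg _) (by positivity)
  have u3 : |(1 - θ) * (Q₁ - J * V₁) + θ * (Q₂ - J * V₂)| ≤ W := by
    refine (abs_add_le _ _).trans ?_
    rw [abs_mul, abs_mul, abs_of_nonneg h0, abs_of_nonneg (by linarith : 0 ≤ 1 - θ)]
    nlinarith
  have e : (1 - θ) * Q₁ + θ * Q₂ - 2 * M * (θ * (1 - θ)) * S₁ + 2 * M * (θ * (1 - θ)) * S₂ +
      J * (θ * (1 - θ) * M ^ 2) - J * V =
      ((1 - θ) * (Q₁ - J * V₁) + θ * (Q₂ - J * V₂)) - 2 * M * (θ * (1 - θ)) * S₁ +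
        2 * M * (θ * (1 - θ)) * S₂ := by
    rw [hV]; ring
  rw [e]
  have u1 := abs_le.mp (key S₁ hS₁)
  have u2 := abs_le.mp (key S₂ hS₂)
  have u3 := abs_le.mp u3
  rw [abs_le]
  constructor <;> linarith [u1.1, u1.2, u2.1, u2.2, u3.1, u3.2]

/-- Replace [X, 2X] by [⌊X⌋, ⌊2X⌋]: the two fractional ends are handled by the pointwise bound. The
rest is exact integration over unit intervals, so the integer-length estimates for ⌊H⌋ and ⌊H⌋ + 1
combine with the interpolation identity. -/
theorem abs_integral_schemmelShortSum_sub_le {m : ℕ} (hm : 1 ≤ m) {δ : ℝ} (hδ : 0 < δ)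
    (hδ' : δ ≤ 1 / 4) :
    ∃ K : ℝ, 0 ≤ K ∧ ∀ X H : ℝ, 1 ≤ H → H ≤ X →
      |(∫ x in X..(2 * X), |schemmelShortSum m H x - schemmelMass m * H| ^ 2) -
        X * schemmelVar m H| ≤ K * H * (5 * X) ^ (10 * δ) := by
  obtain ⟨B, hB0, hB⟩ := abs_sum_sq_schemmelDisc_sub_le hm hδ hδ'
  obtain ⟨C, _, hC⟩ := exists_abs_schemmelCoeff_le hm hδ
  set V := C ^ 2 * (∑' n, errWeight δ n) ^ 2 with hV
  have hV0 : 0 ≤ V := by positivity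
  set M := schemmelMass m with hM
  refine ⟨2 * (B + |M|) ^ 2 + 2 * (1 + 4 * |M|) * B + V, by positivity, fun X H hH1 hHX => ?_⟩
  have hX1 : 1 ≤ X := hH1.trans hHX
  have hX0 : 0 ≤ X := by linarith
  have hH0 : 0 ≤ H := by linarith
  set N := ⌊X⌋₊ with hN
  set N' := ⌊2 * X⌋₊ with hN'
  set L := ⌊H⌋₊ with hL
  set θ := H - L with hθ
  have hNX : (N : ℝ) ≤ X := Nat.floor_le hX0
  have hXN : X < N + 1 := Nat.lt_floor_add_one X
  have hNX' : (N' : ℝ) ≤ 2 * X := Nat.floor_le (by linarith)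
  have hXN' : 2 * X < N' + 1 := Nat.lt_floor_add_one _
  have hLH : (L : ℝ) ≤ H := Nat.floor_le hH0
  have hHL : H < L + 1 := Nat.lt_floor_add_one H
  have hN1 : 1 ≤ N := Nat.le_floor (by simpa using hX1)
  have hLN : L ≤ N := Nat.floor_le_floor hHX
  have hNN : N ≤ N' := Nat.floor_le_floor (by linarith)
  have hN'2 : N' ≤ 2 * N + 1 := by
    have : (N' : ℝ) < 2 * N + 2 := by linarith
    have : N' < 2 * N + 2 := by exact_mod_cast this
    omega
  have hθ0 : 0 ≤ θ := by simp only [hθ]; linarith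
  have hθ1 : θ < 1 := by simp only [hθ]; linarith
  -- The cutoff 5N suffices for both lengths: N' + L + 1 ≤ (2N + 1) + N + 1 ≤ 5N, as N ≥ 1.
  obtain ⟨p1, s1, q1⟩ := hB L N N' (5 * N) hNN (by omega) (by omega)
  obtain ⟨p2, s2, q2⟩ := hB (L + 1) N N' (5 * N) hNN (by omega) (by omega)
  set y : ℝ := ((5 * N : ℕ) : ℝ) ^ (5 * δ) with hy
  have hy1 : 1 ≤ y := Real.one_le_rpow (by exact_mod_cast (by omega : 1 ≤ 5 * N)) (by linarith)
  have hy2 : y ^ 2 ≤ (5 * X) ^ (10 * δ) := by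
    rw [hy, ← Real.rpow_mul_natCast (by positivity)]
    push_cast
    rw [show 5 * δ * 2 = 10 * δ by ring]
    gcongr
  have hyy : y ≤ y ^ 2 := by nlinarith
  set φ : ℝ → ℝ := fun x => |schemmelShortSum m H x - M * H| ^ 2 with hφ
  have hφb : ∀ a ∈ Icc N N', ∀ x : ℝ, (a : ℝ) ≤ x → x < a + 1 → ‖φ x‖ ≤ (B + |M|) ^ 2 * y ^ 2 := by
    intro a ha x h1 h2
    have h3 := abs_schemmelShortSum_sub_le hm hH0 h1 h2 (p1 a ha) (p2 a ha)
    rw [Real.norm_of_nonneg (by simp only [hφ]; positivity), ← mul_pow]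
    refine pow_le_pow_left₀ (abs_nonneg _) (h3.trans ?_) 2
    nlinarith [abs_nonneg M]
  -- Integrability is taken up to N' + 1, since 2X may exceed N'.
  have hmono : ∀ {a b : ℝ}, (N : ℝ) ≤ a → a ≤ b → b ≤ N' + 1 →
      IntervalIntegrable φ MeasureTheory.volume a b := by
    intro a b h1 h2 h3
    refine (integral_nat_schemmelShortSum hm hH0 rfl rfl (by omega : N ≤ N' + 1)).1.mono_set ?_
    rw [Set.uIcc_of_le h2, Set.uIcc_of_le (by push_cast; linarith)]
    push_cast
    exact Set.Icc_subset_Icc h1 h3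
  have hXN'' : X ≤ N' + 1 := by linarith
  have hNN' : (N : ℝ) ≤ N' := by exact_mod_cast hNN
  have hsplit : ∫ x in X..(2 * X), φ x =
      (∫ x in (N : ℝ)..N', φ x) - (∫ x in (N : ℝ)..X, φ x) + ∫ x in (N' : ℝ)..(2 * X), φ x := by
    have e1 := intervalIntegral.integral_add_adjacent_intervals
      (hmono le_rfl hNX hXN'') (hmono hNX (by linarith) hXN'.le)
    have e2 := intervalIntegral.integral_add_adjacent_intervals
      (hmono le_rfl hNN' (by linarith)) (hmono hNN' hNX' hXN'.le)
    linarith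
  have hb0 : 0 ≤ (B + |M|) ^ 2 * y ^ 2 := by positivity
  have hb1 : |∫ x in (N : ℝ)..X, φ x| ≤ (B + |M|) ^ 2 * y ^ 2 :=
    abs_integral_le_of_length_le_one hNX hXN.le hb0 fun x h1 h2 =>
      hφb N (by rw [Finset.mem_Icc]; omega) x h1 (by linarith)
  have hb2 : |∫ x in (N' : ℝ)..(2 * X), φ x| ≤ (B + |M|) ^ 2 * y ^ 2 :=
    abs_integral_le_of_length_le_one hNX' hXN'.le hb0 fun x h1 h2 =>
      hφb N' (by rw [Finset.mem_Icc]; omega) x h1 (by linarith)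
  have hmain := (integral_nat_schemmelShortSum hm hH0 hL.symm hθ.symm hNN).2
  have hVH : schemmelVar m H = (1 - θ) * schemmelVar m L + θ * schemmelVar m (L + 1 : ℕ) +
      θ * (1 - θ) * M ^ 2 := by
    rw [← schemmelVar_interpolate hm L hθ0 hθ1, hθ, add_sub_cancel]
  have hVb : |schemmelVar m H| ≤ V * H := by
    have := abs_schemmelVar_le hC hδ hδ' H
    rwa [abs_of_nonneg hH0] at this
  have hJ : |((N' : ℝ) - N - X) * schemmelVar m H| ≤ V * H := by
    rw [abs_mul]
    refine (mul_le_of_le_one_left (abs_nonneg _) ?_).trans hVb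
    rw [abs_le]; constructor <;> linarith
  have hLb : (((L + 1 : ℕ) : ℝ)) ≤ 2 * H := by push_cast; linarith
  have hLb' : (L : ℝ) ≤ 2 * H := by linarith
  have hW1 : ∀ {z : ℝ} {l : ℕ}, (l : ℝ) ≤ 2 * H → |z| ≤ B * l * y → |z| ≤ B * (2 * H) * y :=
    fun hl hz => hz.trans (by gcongr)
  have hcomb := abs_interpolation_error_le hθ0 hθ1.le (hW1 hLb' s1) (hW1 hLb s2) (hW1 hLb' q1)
    (hW1 hLb q2) hVH
  rw [← hmain] at hcomb
  have hfin : |(∫ x in X..(2 * X), φ x) - X * schemmelVar m H| ≤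
      2 * ((B + |M|) ^ 2 * y ^ 2) + (1 + 4 * |M|) * (B * (2 * H) * y) + V * H := by
    rw [hsplit]
    have c1 := abs_le.mp hcomb
    have c2 := abs_le.mp hJ
    have c3 := abs_le.mp hb1
    have c4 := abs_le.mp hb2
    rw [abs_le]
    constructor <;> linarith [c1.1, c1.2, c2.1, c2.2, c3.1, c3.2, c4.1, c4.2]
  refine hfin.trans ?_
  calc _ ≤ 2 * ((B + |M|) ^ 2 * (H * y ^ 2)) + (1 + 4 * |M|) * (B * (2 * H) * y ^ 2) +
          V * (H * y ^ 2) := by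
        have hy21 : 1 ≤ y ^ 2 := one_le_pow₀ hy1
        gcongr
        · exact le_mul_of_one_le_left (by positivity) hH1
        · exact le_mul_of_one_le_right hH0 hy21
    _ = (2 * (B + |M|) ^ 2 + 2 * (1 + 4 * |M|) * B + V) * H * y ^ 2 := by ring
    _ ≤ _ := by gcongr

/-! ### Short windows and the final estimate -/

/-- For H ≤ 1 the window holds at most one integer, so both quantities are bounded outright, which
suffices because H^(-ε) ≥ 1. -/
theorem abs_variance_sub_le_of_le_one {m : ℕ} (hm : 1 ≤ m) :
    ∃ K : ℝ, 0 ≤ K ∧ ∀ X H : ℝ, 1 ≤ X → 0 < H → H ≤ 1 →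
      |(1 / X) * (∫ x in X..(2 * X), |schemmelShortSum m H x - schemmelMass m * H| ^ 2) -
        schemmelVar m H| ≤ K := by
  obtain ⟨C, _, hC⟩ := exists_abs_schemmelCoeff_le hm (show (0 : ℝ) < 1 / 4 by norm_num)
  set V := C ^ 2 * (∑' n, errWeight (1 / 4) n) ^ 2 with hV
  refine ⟨(1 + |schemmelMass m|) ^ 2 + V, by positivity, fun X H hX hH0 hH1 => ?_⟩
  have hX0 : 0 < X := by linarith
  have h1 : |schemmelVar m H| ≤ V := by
    have := abs_schemmelVar_le hC (by norm_num) le_rfl H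
    rw [abs_of_pos hH0] at this
    exact this.trans (mul_le_of_le_one_right (by positivity) hH1)
  have h2 : ‖∫ x in X..(2 * X), |schemmelShortSum m H x - schemmelMass m * H| ^ 2‖ ≤
      (1 + |schemmelMass m|) ^ 2 * |2 * X - X| := by
    refine intervalIntegral.norm_integral_le_of_norm_le_const fun x hx => ?_
    rw [Set.uIoc_of_le (by linarith)] at hx
    rw [Real.norm_of_nonneg (by positivity)]
    refine pow_le_pow_left₀ (abs_nonneg _) ((abs_sub _ _).trans (add_le_add
      (abs_schemmelShortSum_le hH1 (by linarith [hx.1])) ?_)) 2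
    rw [abs_mul, abs_of_pos hH0]
    exact mul_le_of_le_one_right (abs_nonneg _) hH1
  refine (abs_sub _ _).trans (add_le_add ?_ h1)
  rw [abs_mul, abs_of_pos (by positivity), one_div, inv_mul_le_iff₀ hX0]
  rw [show 2 * X - X = X by ring, abs_of_pos hX0, Real.norm_eq_abs] at h2
  linarith

theorem corollary1p8 (m : ℕ) (hm : 1 ≤ m) :
    Multipliable (schemmelMeanFactor m) ∧
    (∀ d : ℕ, Multipliable (schemmelVarFactor m d)) ∧
    (∀ H : ℝ, Summable (schemmelVarTerm m H)) ∧
    ∀ ε : ℝ, 0 < ε →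
      ∃ C : ℝ, ∀ X H : ℝ, 1 ≤ X → 0 < H → H ≤ X ^ (1 - ε) →
        |(1 / X) * (∫ x in X..(2 * X), |schemmelShortSum m H x - schemmelMean m * H| ^ 2) -
            schemmelVarConst m H| ≤ C * H ^ (-ε) := by
  refine ⟨multipliable_schemmelMeanFactor m, multipliable_schemmelVarFactor m,
    fun H => (hasSum_schemmelVarTerm hm H).summable, fun ε hε => ?_⟩
  have hvar : ∀ H, schemmelVarConst m H = schemmelVar m H := fun H =>
    (hasSum_schemmelVarTerm hm H).tsum_eq
  simp only [hvar, schemmelMean_eq hm]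
  obtain ⟨K, hK0, hK⟩ := abs_variance_sub_le_of_le_one hm
  have hsmall : ∀ X H : ℝ, 1 ≤ X → 0 < H → H ≤ 1 →
      |(1 / X) * (∫ x in X..(2 * X), |schemmelShortSum m H x - schemmelMass m * H| ^ 2) -
        schemmelVar m H| ≤ K * H ^ (-ε) := fun X H hX hH0 hH1 =>
    (hK X H hX hH0 hH1).trans (le_mul_of_one_le_right hK0
      (Real.one_le_rpow_of_pos_of_le_one_of_nonpos hH0 hH1 (by linarith)))
  -- If ε ≥ 1 then X^(1-ε) ≤ 1, so only H ≤ 1 occurs.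
  rcases le_or_gt 1 ε with hε1 | hε1
  · exact ⟨K, fun X H hX hH0 hHX => hsmall X H hX hH0
      (hHX.trans (Real.rpow_le_one_of_one_le_of_nonpos hX (by linarith)))⟩
  -- With δ = ε²/10 the loss X^(10δ) is X^(ε²), and raising H ≤ X^(1-ε) to the power 1 + ε gives
  -- exactly H^(1+ε) ≤ X^(1-ε²).
  obtain ⟨K', hK'0, hK'⟩ := abs_integral_schemmelShortSum_sub_le hm
    (show 0 < ε ^ 2 / 10 by positivity) (by nlinarith)
  refine ⟨K + 5 * K', fun X H hX hH0 hHX => ?_⟩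
  have hp : 0 < H ^ (-ε) := Real.rpow_pos_of_pos hH0 _
  rcases le_or_gt H 1 with hH1 | hH1
  · refine (hsmall X H hX hH0 hH1).trans ?_
    gcongr
    linarith
  have hX0 : 0 < X := by linarith
  have hHX' : H ≤ X := hHX.trans (Real.rpow_le_self_of_one_le hX (by linarith))
  have h1 := hK' X H hH1.le hHX'
  rw [show 10 * (ε ^ 2 / 10) = ε ^ 2 by ring] at h1
  have h2 : (5 * X) ^ (ε ^ 2) ≤ 5 * X ^ (ε ^ 2) := by
    rw [Real.mul_rpow (by norm_num) hX0.le]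
    gcongr
    exact Real.rpow_le_self_of_one_le (by norm_num) (by nlinarith)
  have h3 : H * X ^ (ε ^ 2) ≤ X * H ^ (-ε) := by
    have h4 : H ^ (1 + ε) ≤ X ^ (1 - ε ^ 2) := by
      calc H ^ (1 + ε) ≤ (X ^ (1 - ε)) ^ (1 + ε) := by gcongr
        _ = _ := by rw [← Real.rpow_mul hX0.le]; ring_nf
    rw [Real.rpow_sub hX0, Real.rpow_one, Real.rpow_add hH0, Real.rpow_one, le_div_iff₀ (by positivity)] at h4
    rw [Real.rpow_neg hH0.le, ← div_eq_mul_inv, le_div_iff₀ (by positivity)]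
    linarith
  have h5 : (1 / X) * (∫ x in X..(2 * X), |schemmelShortSum m H x - schemmelMass m * H| ^ 2) -
      schemmelVar m H = (1 / X) *
        ((∫ x in X..(2 * X), |schemmelShortSum m H x - schemmelMass m * H| ^ 2) -
          X * schemmelVar m H) := by field_simp
  rw [h5, abs_mul, abs_of_pos (by positivity), one_div, inv_mul_le_iff₀ hX0]
  calc _ ≤ K' * H * (5 * X ^ (ε ^ 2)) := h1.trans (by gcongr)
    _ = 5 * K' * (H * X ^ (ε ^ 2)) := by ring
    _ ≤ 5 * K' * (X * H ^ (-ε)) := by gcongr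
    _ ≤ _ := by
        have : 0 ≤ K * (X * H ^ (-ε)) := by positivity
        linarith
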